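/- Let $k$ be an algebraically closed field of arbitrary characteristic, and let $d, j \ge 0$ be integers. A staircase in $\mathbb N^d$ is a subset $E$ with $(\mathbb N^d\setminus E)+\mathbb N^d\subset \mathbb N^d\setminus E$; $I^E\subset k[[x_1,\dots,x_d]]$ denotes the ideal of the series $\sum c_\alpha x^\alpha$ with $c_\alpha=0$ for all $\alpha\in E$. A zero-dimensional subscheme of $\mathbb P^d_k$ supported at a point $q$ is monomial with staircase $E$ if it is defined by $I^E$ in a suitable formal neighborhood $\operatorname{Spec} k[[x_1,\dots,x_d]]\hookrightarrow\mathbb P^d$ of $q$ (for $E=\emptyset$ it is the empty subscheme). For finite staircases $E_1,\dots,E_r$ let $C(E_1,\dots,E_r)$ be the subset of the Hilbert scheme of zero-dimensional subschemes of $\mathbb P^d_k$ whose points parametrize the disjoint unions $Z=\coprod_{i=1}^r Z_i$, where $Z_i$ is monomial with staircase $E_i$ and the $Z_i$ are supported at $r$ distinct points. For positive integers $a_1,\dots,a_d$ let $(a_1,\dots,a_d).E$ be the smallest staircase which contains $(a_1(m_1+1)-1,\dots,a_d(m_d+1)-1)$ for every $(m_1,\dots,m_d)\in E$, and put $s.E=(s,\dots,s).E$.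 Closures are taken in the Zariski topology of the Hilbert scheme. Let $E,E_1,\dots,E_j$ be finite staircases in $\mathbb N^d$. Then, for all positive integers $a_1,\dots,a_d$, $$\overline{C(\underbrace{E,\dots,E}_{\prod_i a_i\text{ times}},E_1,\dots,E_j)}\supset C((a_1,\dots,a_d).E,E_1,\dots,E_j).$$ In particular, for every positive integer $s$, $$\overline{C(\underbrace{E,\dots,E}_{s^d\text{ times}},E_1,\dots,E_j)}\supset C(s.E,E_1,\dots,E_j).$$ -/

import Mathlib

/-- A finite staircase in `ℕ^d`: a finite subset whose complement is stable under adding elements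
of `ℕ^d`. -/
structure Staircase (d : ℕ) where
  carrier : Set (Fin d →₀ ℕ)
  add_notMem : ∀ α, α ∉ carrier → ∀ β, α + β ∉ carrier
  finite : carrier.Finite

namespace Staircase

/-- The set `F` is a (possibly infinite) staircase containing
`(a_1 (m_1 + 1) - 1, …, a_d (m_d + 1) - 1)` for every `(m_1, …, m_d)` in `E`. -/
def IsScaleBound {d : ℕ} (E : Staircase d) (a : Fin d → ℕ) (F : Set (Fin d →₀ ℕ)) : Prop :=
  (∀ α, α ∉ F → ∀ β, α + β ∉ F) ∧
    ∀ m ∈ E.carrier, Finsupp.equivFunOnFinite.symm (fun i => a i * (m i + 1) - 1) ∈ F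

/-- The set of exponents below one of the corners `a_i (m_i + 1) - 1`, `m ∈ E`. -/
theorem isScaleBound_below {d : ℕ} (E : Staircase d) (a : Fin d → ℕ) :
    E.IsScaleBound a
      {α | ∃ m ∈ E.carrier, ∀ i, α i ≤ a i * (m i + 1) - 1} := by
  refine ⟨?_, ?_⟩
  · rintro α hα β ⟨m, hm, h⟩
    exact hα ⟨m, hm, fun i => le_trans (by simp) (h i)⟩
  · intro m hm
    exact ⟨m, hm, fun i => by simp⟩

theorem below_finite {d : ℕ} (E : Staircase d) (a : Fin d → ℕ) :
    {α : Fin d →₀ ℕ | ∃ m ∈ E.carrier, ∀ i, α i ≤ a i * (m i + 1) - 1}.Finite := by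
  have h : {α : Fin d →₀ ℕ | ∃ m ∈ E.carrier, ∀ i, α i ≤ a i * (m i + 1) - 1} =
      ⋃ m ∈ E.carrier,
        Set.Iic (Finsupp.equivFunOnFinite.symm (fun i => a i * (m i + 1) - 1)) := by
    ext α
    simp [Finsupp.le_def]
  rw [h]
  exact E.finite.biUnion fun m _ => Set.finite_Iic _

/-- The staircase `(a_1, …, a_d).E`: the smallest staircase containing
`(a_1 (m_1 + 1) - 1, …, a_d (m_d + 1) - 1)` for every `(m_1, …, m_d)` in `E`
(used for positive `a_i` only). -/
def scale {d : ℕ} (a : Fin d → ℕ) (E : Staircase d) : Staircase d where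
  carrier := ⋂₀ {F | E.IsScaleBound a F}
  add_notMem := by
    intro α hα β h
    apply hα
    intro F hF
    by_contra hαF
    exact hF.1 α hαF β (h F hF)
  finite := (E.below_finite a).subset (Set.sInter_subset_of_mem (E.isScaleBound_below a))

/-- The ideal `I^E` of `k[[x_1, …, x_d]]`: the series all of whose coefficients with exponent in
`E` vanish. -/
noncomputable def monomialIdeal (k : Type*) [Field k] {d : ℕ} (E : Staircase d) :
    Ideal (MvPowerSeries (Fin d) k) where
  carrier := {f | ∀ α ∈ E.carrier, MvPowerSeries.coeff α f = 0}
  zero_mem' := by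
    intro α _
    simp
  add_mem' := by
    intro f g hf hg α hα
    rw [map_add, hf α hα, hg α hα, add_zero]
  smul_mem' := by
    classical
    intro c f hf α hα
    rw [smul_eq_mul, MvPowerSeries.coeff_mul]
    refine Finset.sum_eq_zero fun p hp => ?_
    have hp' : p.1 + p.2 = α := Finset.HasAntidiagonal.mem_antidiagonal.1 hp
    have h2 : p.2 ∈ E.carrier := by
      by_contra h
      apply E.add_notMem p.2 h p.1
      rwa [add_comm, hp']
    rw [hf p.2 h2, mul_zero]

end Staircase

/-- The degree `m` part `k[X_0, …, X_d]_m` of the homogeneous coordinate ring of `ℙ^d`. -/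
noncomputable abbrev Forms (k : Type*) [Field k] (d m : ℕ) : Submodule k (MvPolynomial (Fin (d + 1)) k) :=
  MvPolynomial.homogeneousSubmodule (Fin (d + 1)) k m

/-- The degree `m` part `I_m` of an ideal of `k[X_0, …, X_d]`, as a subspace of the forms of
degree `m`. -/
noncomputable abbrev idealForms {k : Type*} [Field k] {d : ℕ} (I : Ideal (MvPolynomial (Fin (d + 1)) k))
    (m : ℕ) : Submodule k (Forms k d m) :=
  (I.restrictScalars k).comap (Forms k d m).subtype

/-- A closed subscheme of `ℙ^d` with constant Hilbert polynomial `n` (a zero-dimensional subscheme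
of length `n`; empty if `n = 0`), given by its saturated homogeneous ideal. Over an algebraically
closed field `k` these are the closed points of the Hilbert scheme `Hilb^n(ℙ^d)`. -/
@[ext]
structure HilbPoint (k : Type*) [Field k] (d n : ℕ) where
  ideal : Ideal (MvPolynomial (Fin (d + 1)) k)
  homogeneous : ∀ f ∈ ideal, ∀ m, MvPolynomial.homogeneousComponent m f ∈ ideal
  saturated : ∀ f, (∃ N : ℕ, ∀ i, MvPolynomial.X i ^ N * f ∈ ideal) → f ∈ ideal
  hilbertPolynomial : ∀ᶠ m in Filter.atTop,
    Module.finrank k (Forms k d m ⧸ idealForms ideal m) = n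

/-- The Plücker coordinates of a quotient `V ⧸ W` of dimension `n`, with respect to a basis `b` of
it: one coordinate for each `n`-tuple of vectors of `V`. Another choice of `b` multiplies all of
them by the same nonzero scalar. -/
noncomputable def pluckerCoord {k V : Type*} [Field k] [AddCommGroup V] [Module k V]
    (W : Submodule k V) {n : ℕ} (b : Module.Basis (Fin n) k (V ⧸ W)) (v : Fin n → V) : k :=
  b.det (fun i => W.mkQ (v i))

/-- The basic open subset of `Hilb^n(ℙ^d)` given by a degree `m` and a homogeneous polynomial `F`
in the Plücker coordinates of the Grassmannian of `n`-dimensional quotients of the space of forms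
of degree `m`: the subschemes `Z` for which `k[X_0, …, X_d]_m ⧸ I_{Z,m}` has dimension `n` and
`F` does not vanish at its Plücker coordinates. -/
def HilbPoint.basicOpen {k : Type*} [Field k] {d n : ℕ} (m : ℕ)
    (F : MvPolynomial (Fin n → Forms k d m) k) : Set (HilbPoint k d n) :=
  {Z | ∃ b : Module.Basis (Fin n) k (Forms k d m ⧸ idealForms Z.ideal m),
    MvPolynomial.eval (pluckerCoord (idealForms Z.ideal m) b) F ≠ 0}

/-- The Zariski topology on the closed points of `Hilb^n(ℙ^d)`. For every `m ≥ n` all `Z` satisfy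
`dim k[X_0, …, X_d]_m ⧸ I_{Z,m} = n`, and `Z ↦ I_{Z,m}` is the standard closed embedding of the
Hilbert scheme in the Grassmannian of `n`-dimensional quotients of the forms of degree `m`; the
topology is the one induced by the Zariski topology of this Grassmannian. (For `m < n` the
condition on the dimension is open, so these degrees add no open sets.) -/
instance HilbPoint.instTopologicalSpace (k : Type*) [Field k] (d n : ℕ) :
    TopologicalSpace (HilbPoint k d n) :=
  TopologicalSpace.generateFrom
    {U | ∃ (m : ℕ) (F : MvPolynomial (Fin n → Forms k d m) k) (e : ℕ),
      F.IsHomogeneous e ∧ U = HilbPoint.basicOpen m F}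

/-- The closed points of the Hilbert scheme of zero-dimensional subschemes of `ℙ^d`: the disjoint
union, over all lengths `n`, of the `Hilb^n(ℙ^d)`, with the topology of a disjoint union. -/
abbrev Hilb (k : Type*) [Field k] (d : ℕ) : Type _ := Σ n : ℕ, HilbPoint k d n

/-- A formal neighborhood `Spec k[[x_1, …, x_d]] ↪ ℙ^d` of a point, in homogeneous coordinates
`[φ_0 : … : φ_d]`. The vectors `φ(0), ∂φ/∂x_1(0), …, ∂φ/∂x_d(0)` are required to be linearly
independent; this says exactly that `φ(0)` defines a point `q` of `ℙ^d` and that `φ` identifies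
the completed local ring of `ℙ^d` at `q` with `k[[x_1, …, x_d]]`. -/
structure FormalNeighborhood (k : Type*) [Field k] (d : ℕ) where
  coord : Fin (d + 1) → MvPowerSeries (Fin d) k
  linearIndependent : LinearIndependent k
    (Fin.cons (fun i => MvPowerSeries.constantCoeff (coord i))
      (fun l i => MvPowerSeries.coeff (Finsupp.single l 1) (coord i)) :
        Fin (d + 1) → Fin (d + 1) → k)

namespace FormalNeighborhood

variable {k : Type*} [Field k] {d : ℕ}

/-- The point of `ℙ^d` at which a formal neighborhood is centered. -/
noncomputable def center (φ : FormalNeighborhood k d) : Projectivization k (Fin (d + 1) → k) :=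
  Projectivization.mk k (fun i => MvPowerSeries.constantCoeff (φ.coord i))
    (φ.linearIndependent.ne_zero 0)

/-- The ideal of `k[[x_1, …, x_d]]` which defines the restriction to the formal neighborhood of the
subscheme of `ℙ^d` with homogeneous ideal `I`. -/
noncomputable def pullback (φ : FormalNeighborhood k d)
    (I : Ideal (MvPolynomial (Fin (d + 1)) k)) : Ideal (MvPowerSeries (Fin d) k) :=
  I.map (MvPolynomial.aeval φ.coord)

end FormalNeighborhood

/-- A point `q` of `ℙ^d` lies on the subscheme with homogeneous ideal `I`. -/
def OnSubscheme {k : Type*} [Field k] {d : ℕ} (I : Ideal (MvPolynomial (Fin (d + 1)) k))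
    (q : Projectivization k (Fin (d + 1) → k)) : Prop :=
  ∀ f ∈ I, MvPolynomial.eval q.rep f = 0

/-- The stratum `C(E_1, …, E_r)` (its set of closed points): the subschemes `Z` of `ℙ^d` which are
disjoint unions of `r` monomial subschemes with staircases `E_1, …, E_r`, supported by distinct
points. That is, there are formal neighborhoods of `r` distinct points in which `Z` is defined by
`I^{E_1}, …, I^{E_r}`, and `Z` contains no other point. -/
def stratum (k : Type*) [Field k] {d r : ℕ} (E : Fin r → Staircase d) : Set (Hilb k d) :=
  {Z | ∃ φ : Fin r → FormalNeighborhood k d,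
    Function.Injective (fun i => (φ i).center) ∧
    (∀ i, (φ i).pullback Z.2.ideal = (E i).monomialIdeal k) ∧
    ∀ q, OnSubscheme Z.2.ideal q → ∃ i, q = (φ i).center}

/-! A grid of `∏ a_i` points carrying the staircase `E` collapses to one point carrying `a.E`, and
Newton interpolation describes the collapse. In one variable, take distinct `z_0, …, z_{a-1}` and
repeat the nodes `t z_0, …, t z_{a-1}` periodically. For `t ≠ 0` the Newton coordinates of index `l
< a m` depend only on the class modulo `∏ (x - t z_c)^m`. Hence they are combinations of the Taylor
coefficients of order less than `m` at the nodes (`exists_newtonFunctional_eq_sum`). For `t = 0`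
they are the ordinary coefficients. In `d` variables, products of such functionals are used. An
exponent `α` lies in `a.E` exactly when `⌊α/a⌋` lies in `E` (`mem_scale`). The Newton coordinate of
index `α` involves only Taylor coefficients at grid points with exponents at most `⌊α/a⌋`. So it
vanishes on every polynomial whose expansions at all grid points avoid `E`
(`prodFunctional_newtonCoeff_eq_zero`). To globalize, a point `Z` of the small stratum is recovered
from its neighborhoods and staircases (`HilbPoint.ideal_eq_monomialSubschemeIdeal`), so its forms
are the kernel of a map to `k^n` reading off jet coefficients. The first neighborhood is replaced by
a polynomial map `P` with the same relevant jets. Unlike a power series, `P` can be re-expanded at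
the grid points, which gives subschemes `W_t` in the big stratum for almost all `t`. Replacing the
coefficients at the first point by Newton coordinates gives linear maps `ev t`, polynomial in `t`,
with `ker (ev 0) = I_Z` and `ker (ev t) ⊇ I_{W_t}`. Since `|a.E| = ∏ a_i · |E|`, the lengths agree,
and the inclusion is an equality in every degree where `ev t` is onto. Plücker coordinates of these
kernels are minors of `ev t`, hence polynomials in `t`, so an open condition valid at `t = 0` holds
for almost all `t` (`HilbPoint.mem_closure_of_polynomial_family`). The characteristic plays no role:
the nodes only have to be distinct. -/

/-! ### Power series filtered by order. -/

namespace Staircase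

/-- The staircase of the exponents of degree less than `M`. -/
def ball (d M : ℕ) : Staircase d where
  carrier := {α | α.degree < M}
  add_notMem := by
    intro α hα β h
    simp only [Set.mem_ofPred_eq, map_add] at hα h
    omega
  finite := by
    refine (Set.finite_Iic (Finsupp.equivFunOnFinite.symm fun _ : Fin d => M)).subset ?_
    intro α hα i
    exact (Finsupp.le_degree i α).trans (le_of_lt hα)

theorem mem_of_le {d : ℕ} (E : Staircase d) {α β : Fin d →₀ ℕ} (h : α ≤ β)
    (hβ : β ∈ E.carrier) : α ∈ E.carrier := by
  by_contra hα
  exact E.add_notMem α hα (β - α) (by rwa [add_tsub_cancel_of_le h])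

theorem exists_subset_ball {d : ℕ} (E : Staircase d) :
    ∃ M, ∀ α ∈ E.carrier, α.degree < M := by
  obtain ⟨M, hM⟩ := (E.finite.image Finsupp.degree).bddAbove
  exact ⟨M + 1, fun α hα => Nat.lt_succ_of_le (hM ⟨α, hα, rfl⟩)⟩

theorem monomialIdeal_anti (k : Type*) [Field k] {d : ℕ} {E F : Staircase d}
    (h : E.carrier ⊆ F.carrier) : F.monomialIdeal k ≤ E.monomialIdeal k :=
  fun _ hf α hα => hf α (h hα)

end Staircase

/-- The ideal of the power series of order at least `M`. -/
noncomputable abbrev orderIdeal (k : Type*) [Field k] (d M : ℕ) : Ideal (MvPowerSeries (Fin d) k) :=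
  (Staircase.ball d M).monomialIdeal k

section OrderIdeal

variable {k : Type*} [Field k] {d : ℕ}

theorem mem_orderIdeal_iff {M : ℕ} {f : MvPowerSeries (Fin d) k} :
    f ∈ orderIdeal k d M ↔ (M : ℕ∞) ≤ f.order := by
  constructor
  · intro h
    exact MvPowerSeries.nat_le_order fun α hα => h α hα
  · intro h α hα
    exact MvPowerSeries.coeff_of_lt_order (lt_of_lt_of_le (by exact_mod_cast hα) h)

theorem orderIdeal_anti {M N : ℕ} (h : M ≤ N) : orderIdeal k d N ≤ orderIdeal k d M :=
  Staircase.monomialIdeal_anti k fun _ hα => lt_of_lt_of_le hα h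

theorem mem_orderIdeal_zero (f : MvPowerSeries (Fin d) k) : f ∈ orderIdeal k d 0 :=
  fun _ hα => absurd hα (Nat.not_lt_zero _)

theorem mem_orderIdeal_one {f : MvPowerSeries (Fin d) k} :
    f ∈ orderIdeal k d 1 ↔ MvPowerSeries.constantCoeff f = 0 := by
  rw [mem_orderIdeal_iff, Nat.cast_one, MvPowerSeries.one_le_order_iff_constCoeff_eq_zero]

theorem mul_mem_orderIdeal {M N : ℕ} {f g : MvPowerSeries (Fin d) k}
    (hf : f ∈ orderIdeal k d M) (hg : g ∈ orderIdeal k d N) : f * g ∈ orderIdeal k d (M + N) := by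
  rw [mem_orderIdeal_iff] at *
  push_cast
  exact (add_le_add hf hg).trans MvPowerSeries.le_order_mul

theorem pow_mem_orderIdeal {M : ℕ} {f : MvPowerSeries (Fin d) k} (hf : f ∈ orderIdeal k d 1) :
    f ^ M ∈ orderIdeal k d M := by
  rw [mem_orderIdeal_iff]
  exact MvPowerSeries.le_order_pow_of_constantCoeff_eq_zero M (mem_orderIdeal_one.1 hf)

theorem monomial_mem_orderIdeal (α : Fin d →₀ ℕ) (c : k) :
    MvPowerSeries.monomial α c ∈ orderIdeal k d α.degree := by
  classical
  intro β hβ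
  rw [MvPowerSeries.coeff_monomial, if_neg]
  rintro rfl
  exact lt_irrefl _ (show β.degree < β.degree from hβ)

/-- If `f ≡ f₀` and `g ≡ g₀` up to higher order terms, then `f g ≡ f₀ g₀` up to higher order
terms. -/
theorem mul_sub_mul_mem_orderIdeal {M N : ℕ} {f f₀ g g₀ : MvPowerSeries (Fin d) k}
    (hf : f - f₀ ∈ orderIdeal k d (M + 1)) (hf₀ : f₀ ∈ orderIdeal k d M)
    (hg : g - g₀ ∈ orderIdeal k d (N + 1)) (hg₀ : g₀ ∈ orderIdeal k d N) :
    f * g - f₀ * g₀ ∈ orderIdeal k d (M + N + 1) := by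
  have h1 : g ∈ orderIdeal k d N := by
    have := add_mem (orderIdeal_anti (Nat.le_succ N) hg) hg₀
    simpa using this
  have e : f * g - f₀ * g₀ = (f - f₀) * g + f₀ * (g - g₀) := by ring
  rw [e]
  refine add_mem ?_ ?_
  · have := mul_mem_orderIdeal hf h1
    rwa [show M + 1 + N = M + N + 1 by ring] at this
  · rw [add_assoc]
    exact mul_mem_orderIdeal hf₀ hg

/-- If `ψ_l = x_l` up to terms of order two, then `ψ^α = x^α` up to higher order terms. -/
theorem prod_pow_sub_monomial_mem_orderIdeal {ψ : Fin d → MvPowerSeries (Fin d) k}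
    (hψ : ∀ l, ψ l - MvPowerSeries.X l ∈ orderIdeal k d 2) (α : Fin d →₀ ℕ) :
    (∏ l, ψ l ^ α l) - MvPowerSeries.monomial α 1 ∈ orderIdeal k d (α.degree + 1) := by
  classical
  induction α using Finsupp.induction_linear with
  | zero => simp
  | add α β ha hb =>
    have := mul_sub_mul_mem_orderIdeal ha (monomial_mem_orderIdeal α 1) hb
      (monomial_mem_orderIdeal β 1)
    rw [MvPowerSeries.monomial_mul_monomial, one_mul] at this
    simpa [pow_add, Finset.prod_mul_distrib, map_add] using this
  | single i n =>
    have e : (∏ l, ψ l ^ (Finsupp.single i n) l) = ψ i ^ n := by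
      rw [Finset.prod_eq_single i]
      · simp
      · intro l _ hl
        simp [Finsupp.single_eq_of_ne hl]
      · simp
    rw [e]
    induction n with
    | zero => simp
    | succ n ih =>
      have h1 : MvPowerSeries.X i ∈ orderIdeal k d 1 := by
        rw [mem_orderIdeal_one]; simp
      have e' : (∏ l, ψ l ^ (Finsupp.single i n) l) = ψ i ^ n := by
        rw [Finset.prod_eq_single i]
        · simp
        · intro l _ hl
          simp [Finsupp.single_eq_of_ne hl]
        · simp
      have := mul_sub_mul_mem_orderIdeal (ih e') (monomial_mem_orderIdeal _ 1) (hψ i) h1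
      rw [MvPowerSeries.X, MvPowerSeries.monomial_mul_monomial, one_mul,
        ← Finsupp.single_add, ← pow_succ] at this
      simpa using this

theorem coeff_prod_pow {ψ : Fin d → MvPowerSeries (Fin d) k}
    (hψ : ∀ l, ψ l - MvPowerSeries.X l ∈ orderIdeal k d 2) {α β : Fin d →₀ ℕ}
    (h : β.degree ≤ α.degree) :
    MvPowerSeries.coeff β (∏ l, ψ l ^ α l) = if β = α then 1 else 0 := by
  classical
  have := prod_pow_sub_monomial_mem_orderIdeal hψ α β (Nat.lt_succ_of_le h)
  rwa [map_sub, sub_eq_zero, MvPowerSeries.coeff_monomial] at this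

/-- Each monomial of positive degree is assigned to the first variable occurring in it; `g i`
collects the monomials assigned to `x_i`, divided by `x_i`. -/
theorem orderIdeal_succ_le (M : ℕ) :
    orderIdeal k d (M + 1) ≤ Ideal.span (Set.range MvPowerSeries.X) * orderIdeal k d M := by
  classical
  intro f hf
  let g : Fin d → MvPowerSeries (Fin d) k := fun i α =>
    if ∀ j < i, α j = 0 then MvPowerSeries.coeff (α + Finsupp.single i 1) f else 0
  have hg : ∀ i α, MvPowerSeries.coeff α (g i) =
    if ∀ j < i, α j = 0 then MvPowerSeries.coeff (α + Finsupp.single i 1) f else 0 :=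
      fun _ _ => rfl
  have hfg : f = ∑ i, MvPowerSeries.X i * g i := by
    ext α
    rw [map_sum]
    have hc : ∀ i, MvPowerSeries.coeff α (MvPowerSeries.X i * g i) =
        if (0 < α i ∧ ∀ j < i, α j = 0) then MvPowerSeries.coeff α f else 0 := by
      intro i
      rw [MvPowerSeries.X, MvPowerSeries.coeff_monomial_mul, one_mul, hg]
      by_cases hi : Finsupp.single i 1 ≤ α
      · have hi' : 0 < α i := by simpa [Nat.pos_iff_ne_zero, Nat.one_le_iff_ne_zero] using hi
        rw [if_pos hi, tsub_add_cancel_of_le hi]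
        simp only [hi', true_and]
        refine if_congr ?_ rfl rfl
        refine forall₂_congr fun j hj => ?_
        simp [Finsupp.single_eq_of_ne hj.ne]
      · have hi' : ¬ 0 < α i := by simpa [Nat.pos_iff_ne_zero, Nat.one_le_iff_ne_zero] using hi
        rw [if_neg hi, if_neg (fun h => hi' h.1)]
    simp only [hc]
    by_cases h0 : α = 0
    · have : MvPowerSeries.coeff α f = 0 := hf α (by
        rw [h0]; exact (by simp : (0 : Fin d →₀ ℕ).degree < M + 1))
      simp [this]
    · have hne : (Finset.univ.filter fun i => 0 < α i).Nonempty := by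
        obtain ⟨i, hi⟩ := Finsupp.ne_iff.1 h0
        exact ⟨i, by simpa [Nat.pos_iff_ne_zero] using hi⟩
      set i₀ := (Finset.univ.filter fun i => 0 < α i).min' hne with hi₀
      have h1 : 0 < α i₀ := by
        have := Finset.min'_mem _ hne
        rw [← hi₀] at this
        simpa using this
      have h2 : ∀ j < i₀, α j = 0 := by
        intro j hj
        by_contra hj'
        have := Finset.min'_le (Finset.univ.filter fun i => 0 < α i) j
          (by simpa [Nat.pos_iff_ne_zero] using hj')
        exact absurd hj (not_lt.2 this)
      rw [Finset.sum_eq_single i₀]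
      · rw [if_pos ⟨h1, h2⟩]
      · intro i _ hi
        rw [if_neg]
        rintro ⟨h3, h4⟩
        rcases lt_trichotomy i i₀ with h | h | h
        · exact h3.ne' (h2 i h)
        · exact hi h
        · exact h1.ne' (h4 i₀ h)
      · simp
  rw [hfg]
  refine Ideal.sum_mem _ fun i _ => Ideal.mul_mem_mul (Ideal.subset_span ⟨i, rfl⟩) ?_
  intro α hα
  rw [hg]
  split_ifs
  · refine hf _ ?_
    have : α.degree < M := hα
    change (α + Finsupp.single i 1).degree < M + 1
    rw [map_add, Finsupp.degree_single]
    omega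
  · rfl

theorem span_X_pow_eq_orderIdeal (M : ℕ) :
    Ideal.span (Set.range (MvPowerSeries.X : Fin d → MvPowerSeries (Fin d) k)) ^ M =
      orderIdeal k d M := by
  apply le_antisymm
  · induction M with
    | zero => exact fun f _ => mem_orderIdeal_zero f
    | succ M ih =>
      rw [pow_succ, Ideal.mul_le]
      intro f hf g hg
      refine mul_mem_orderIdeal (ih hf) ?_
      refine Ideal.span_le.2 ?_ hg
      rintro _ ⟨i, rfl⟩
      exact mem_orderIdeal_one.2 (by simp)
  · induction M with
    | zero => simp
    | succ M ih =>
      rw [pow_succ']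
      exact (orderIdeal_succ_le M).trans (Ideal.mul_mono_right ih)

theorem orderIdeal_fg (M : ℕ) : (orderIdeal k d M).FG := by
  rw [← span_X_pow_eq_orderIdeal]
  exact Submodule.FG.pow (Submodule.fg_span (Set.finite_range _)) M

theorem orderIdeal_one_le_jacobson : orderIdeal k d 1 ≤ Ideal.jacobson ⊥ := by
  refine le_trans ?_ (IsLocalRing.maximalIdeal_le_jacobson _)
  intro f hf
  rw [IsLocalRing.mem_maximalIdeal, mem_nonunits_iff, MvPowerSeries.isUnit_iff_constantCoeff,
    mem_orderIdeal_one.1 hf]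
  simp

theorem exists_orderIdeal_le (E : Staircase d) : ∃ M, orderIdeal k d M ≤ E.monomialIdeal k := by
  obtain ⟨M, hM⟩ := E.exists_subset_ball
  exact ⟨M, Staircase.monomialIdeal_anti k hM⟩

/-- An ideal which contains `I^E` up to terms of arbitrarily high order contains `I^E`. -/
theorem monomialIdeal_le_of_approx (E : Staircase d) (K : Ideal (MvPowerSeries (Fin d) k))
    (h : ∀ M, E.monomialIdeal k ≤ K ⊔ orderIdeal k d M) : E.monomialIdeal k ≤ K := by
  obtain ⟨M, hM⟩ := exists_orderIdeal_le (k := k) E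
  have h1 : orderIdeal k d M ≤ K := by
    -- Nakayama: with `𝔪` the ideal of series of order at least one, `𝔪^M ⊆ I^E ⊆ K + 𝔪 𝔪^M` forces
    -- `𝔪^M ⊆ K`.
    refine Submodule.le_of_le_smul_of_le_jacobson_bot (orderIdeal_fg M)
      orderIdeal_one_le_jacobson ?_
    refine (hM.trans (h (M + 1))).trans (sup_le_sup le_rfl ?_)
    rw [smul_eq_mul, ← span_X_pow_eq_orderIdeal, ← span_X_pow_eq_orderIdeal,
      ← span_X_pow_eq_orderIdeal, ← pow_add, add_comm]
  exact (h M).trans (sup_le le_rfl h1)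

end OrderIdeal

/-! ### Linear forms and scaling of homogeneous polynomials. -/

open MvPolynomial in
/-- The linear form with coefficients `w`. -/
noncomputable def linForm {k : Type*} [Field k] {d : ℕ} (w : Fin (d + 1) → k) :
    MvPolynomial (Fin (d + 1)) k :=
  ∑ i, C (w i) * X i

section LinForm

variable {k : Type*} [Field k] {d : ℕ}

theorem linForm_isHomogeneous (w : Fin (d + 1) → k) : (linForm w).IsHomogeneous 1 :=
  MvPolynomial.IsHomogeneous.sum _ _ _ fun i _ => MvPolynomial.isHomogeneous_C_mul_X (w i) i

theorem aeval_linForm {A : Type*} [CommRing A] [Algebra k A] (x : Fin (d + 1) → A)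
    (w : Fin (d + 1) → k) : MvPolynomial.aeval x (linForm w) = ∑ i, w i • x i := by
  simp [linForm, Algebra.smul_def]

theorem eval_linForm (x w : Fin (d + 1) → k) :
    MvPolynomial.eval x (linForm w) = ∑ i, w i * x i := by
  simp [linForm]

theorem exists_linForm_of_ne {p q : Projectivization k (Fin (d + 1) → k)} (h : p ≠ q) :
    ∃ w, MvPolynomial.eval p.rep (linForm w) = 0 ∧ MvPolynomial.eval q.rep (linForm w) ≠ 0 := by
  have hq : q.rep ∉ Submodule.span k {p.rep} := by
    rw [Submodule.mem_span_singleton]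
    rintro ⟨a, ha⟩
    apply h
    rw [← p.mk_rep, ← q.mk_rep, Projectivization.mk_eq_mk_iff']
    have ha0 : a ≠ 0 := by
      rintro rfl
      exact q.rep_nonzero (by rw [← ha, zero_smul])
    exact ⟨a⁻¹, by rw [← ha, smul_smul, inv_mul_cancel₀ ha0, one_smul]⟩
  obtain ⟨f, hf', hf⟩ := Submodule.exists_le_ker_of_notMem hq
  have e : ∀ x, MvPolynomial.eval x (linForm fun i => f (Pi.single i 1)) = f x := by
    intro x
    rw [eval_linForm, LinearMap.pi_apply_eq_sum_univ f x]
    refine Finset.sum_congr rfl fun i _ => ?_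
    rw [smul_eq_mul, mul_comm]
    congr 2
    ext j
    simp [Pi.single_apply, eq_comm]
  refine ⟨fun i => f (Pi.single i 1), ?_, ?_⟩
  · rw [e]
    exact hf (Submodule.mem_span_singleton_self _)
  · rw [e]; exact hf'

/-- The factor `c` lives in the algebra `A`: it serves for dehomogenizing, with `c` the inverse of a
linear form, and for marking degrees, with `c` a new variable. -/
theorem MvPolynomial.IsHomogeneous.aeval_mul {σ A : Type*} [CommRing A] [Algebra k A]
    {f : MvPolynomial σ k} {D : ℕ} (hf : f.IsHomogeneous D) (c : A) (x : σ → A) :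
    MvPolynomial.aeval (fun i => c * x i) f = c ^ D * MvPolynomial.aeval x f := by
  rw [MvPolynomial.aeval_def, MvPolynomial.aeval_def, MvPolynomial.eval₂_eq, MvPolynomial.eval₂_eq,
    Finset.mul_sum]
  refine Finset.sum_congr rfl fun s hs => ?_
  simp only [mul_pow]
  rw [Finset.prod_mul_distrib, Finset.prod_pow_eq_pow_sum, hf.degree_eq_sum_deg_support hs]
  ring

theorem MvPolynomial.IsHomogeneous.eval_smul {σ : Type*}
    {f : MvPolynomial σ k} {D : ℕ} (hf : f.IsHomogeneous D) (c : k) (x : σ → k) :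
    MvPolynomial.eval (c • x) f = c ^ D * MvPolynomial.eval x f :=
  hf.aeval_mul c x

end LinForm

/-! ### Jets of forms at one point, and the affine chart `L_0 = 1`. -/

namespace FormalNeighborhood

variable {k : Type*} [Field k] {d : ℕ}

theorem constantCoeff_aeval (φ : FormalNeighborhood k d) (f : MvPolynomial (Fin (d + 1)) k) :
    MvPowerSeries.constantCoeff (MvPolynomial.aeval φ.coord f) =
      MvPolynomial.eval (fun i => MvPowerSeries.constantCoeff (φ.coord i)) f := by
  rw [MvPolynomial.aeval_def, MvPolynomial.eval₂_eq, MvPolynomial.eval_eq, map_sum]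
  refine Finset.sum_congr rfl fun s _ => ?_
  rw [map_mul, map_prod]
  simp [MvPowerSeries.algebraMap_apply]

/-- The value of a form at the center is that of its pull back, up to a nonzero scalar. -/
theorem exists_smul_center_rep (φ : FormalNeighborhood k d) :
    ∃ a : k, a ≠ 0 ∧
      (fun i => MvPowerSeries.constantCoeff (φ.coord i)) = a • φ.center.rep := by
  obtain ⟨a, ha⟩ := Projectivization.exists_smul_eq_mk_rep k
    (fun i => MvPowerSeries.constantCoeff (φ.coord i)) (φ.linearIndependent.ne_zero 0)
  refine ⟨(a⁻¹ : kˣ), Units.ne_zero _, ?_⟩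
  rw [center, ← ha, Units.smul_def, smul_smul, Units.inv_mul, one_smul]

theorem eval_center_eq_zero_iff (φ : FormalNeighborhood k d) {f : MvPolynomial (Fin (d + 1)) k}
    {D : ℕ} (hf : f.IsHomogeneous D) :
    MvPolynomial.eval φ.center.rep f = 0 ↔
      MvPowerSeries.constantCoeff (MvPolynomial.aeval φ.coord f) = 0 := by
  obtain ⟨a, ha, h⟩ := φ.exists_smul_center_rep
  rw [constantCoeff_aeval, h, hf.eval_smul]
  simp [ha]

/-- The matrix of the coefficients of degree at most one of the coordinates. -/
noncomputable def jacobian (φ : FormalNeighborhood k d) : Matrix (Fin (d + 1)) (Fin (d + 1)) k :=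
  Matrix.of (Fin.cons (fun i => MvPowerSeries.constantCoeff (φ.coord i))
      (fun l i => MvPowerSeries.coeff (Finsupp.single l 1) (φ.coord i)))

theorem isUnit_jacobian (φ : FormalNeighborhood k d) : IsUnit φ.jacobian :=
  Matrix.linearIndependent_rows_iff_isUnit.1 φ.linearIndependent

/-- The linear forms `L_0, …, L_d` with `L_0 = 1` and `L_l = x_l` to first order in the formal
neighborhood. -/
noncomputable def dualForm (φ : FormalNeighborhood k d) (j : Fin (d + 1)) :
    MvPolynomial (Fin (d + 1)) k :=
  linForm fun i => φ.jacobian⁻¹ i j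

theorem dualForm_isHomogeneous (φ : FormalNeighborhood k d) (j : Fin (d + 1)) :
    (φ.dualForm j).IsHomogeneous 1 :=
  linForm_isHomogeneous _

theorem jacobian_mul_inv (φ : FormalNeighborhood k d) : φ.jacobian * φ.jacobian⁻¹ = 1 :=
  Matrix.mul_nonsing_inv _ ((Matrix.isUnit_iff_isUnit_det _).1 φ.isUnit_jacobian)

theorem inv_mul_jacobian (φ : FormalNeighborhood k d) : φ.jacobian⁻¹ * φ.jacobian = 1 :=
  Matrix.nonsing_inv_mul _ ((Matrix.isUnit_iff_isUnit_det _).1 φ.isUnit_jacobian)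

/-- The pull backs of the forms `L_0, …, L_d`. -/
noncomputable def localForm (φ : FormalNeighborhood k d) (j : Fin (d + 1)) :
    MvPowerSeries (Fin d) k :=
  MvPolynomial.aeval φ.coord (φ.dualForm j)

theorem constantCoeff_localForm (φ : FormalNeighborhood k d) (j : Fin (d + 1)) :
    MvPowerSeries.constantCoeff (φ.localForm j) = (1 : Matrix (Fin (d + 1)) (Fin (d + 1)) k) 0 j := by
  rw [← φ.jacobian_mul_inv, localForm, dualForm, aeval_linForm, map_sum, Matrix.mul_apply]
  refine Finset.sum_congr rfl fun i _ => ?_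
  rw [MvPowerSeries.constantCoeff_smul, smul_eq_mul, mul_comm]
  rfl

theorem coeff_single_localForm (φ : FormalNeighborhood k d) (j : Fin (d + 1)) (l : Fin d) :
    MvPowerSeries.coeff (Finsupp.single l 1) (φ.localForm j) = (1 : Matrix (Fin (d + 1)) (Fin (d + 1)) k) l.succ j := by
  rw [← φ.jacobian_mul_inv, localForm, dualForm, aeval_linForm, map_sum, Matrix.mul_apply]
  refine Finset.sum_congr rfl fun i _ => ?_
  rw [MvPowerSeries.coeff_smul, mul_comm]
  rfl

theorem constantCoeff_localForm_zero (φ : FormalNeighborhood k d) :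
    MvPowerSeries.constantCoeff (φ.localForm 0) = 1 := by
  rw [constantCoeff_localForm, Matrix.one_apply_eq]

theorem localForm_succ_sub_X_mem (φ : FormalNeighborhood k d) (l : Fin d) :
    φ.localForm l.succ - MvPowerSeries.X l ∈ orderIdeal k d 2 := by
  classical
  intro α hα
  have hα' : α.degree = 0 ∨ α.degree = 1 := by
    have : α.degree < 2 := hα
    omega
  rcases hα' with h | h
  · rw [Finsupp.degree_eq_zero_iff] at h
    subst h
    have := φ.constantCoeff_localForm l.succ
    rw [Matrix.one_apply_ne (Fin.succ_ne_zero l).symm] at this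
    simp [this]
  · obtain ⟨i, rfl⟩ := (Finsupp.sum_eq_one_iff α).1 (by rwa [Finsupp.degree_apply] at h)
    rw [map_sub, coeff_single_localForm, MvPowerSeries.coeff_X, Matrix.one_apply]
    simp [Finsupp.single_left_inj, eq_comm]

theorem X_eq_sum_dualForm (φ : FormalNeighborhood k d) (i : Fin (d + 1)) :
    MvPolynomial.X i = ∑ j, MvPolynomial.C (φ.jacobian j i) * φ.dualForm j := by
  have h : ∀ i', ∑ j, φ.jacobian j i * φ.jacobian⁻¹ i' j = if i' = i then 1 else 0 := by
    intro i'
    rw [← Matrix.one_apply, ← φ.inv_mul_jacobian, Matrix.mul_apply]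
    exact Finset.sum_congr rfl fun j _ => mul_comm _ _
  simp only [dualForm, linForm, Finset.mul_sum]
  rw [Finset.sum_comm]
  simp only [← mul_assoc, ← map_mul, ← Finset.sum_mul, ← map_sum, h]
  simp

/-- The pulled back product is `x^α` plus terms of higher order. This triangularity lets jets be
corrected one degree at a time. -/
theorem coeff_localForm_prod (φ : FormalNeighborhood k d) (e : ℕ) {α β : Fin d →₀ ℕ}
    (h : β.degree ≤ α.degree) :
    MvPowerSeries.coeff β (φ.localForm 0 ^ e * ∏ l : Fin d, φ.localForm l.succ ^ α l) =
      if β = α then 1 else 0 := by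
  classical
  have h1 : φ.localForm 0 ^ e - 1 ∈ orderIdeal k d (0 + 1) := by
    rw [mem_orderIdeal_one]
    simp [constantCoeff_localForm_zero]
  have := mul_sub_mul_mem_orderIdeal h1 (mem_orderIdeal_zero 1)
    (prod_pow_sub_monomial_mem_orderIdeal φ.localForm_succ_sub_X_mem α)
    (monomial_mem_orderIdeal α 1) β (by change β.degree < 0 + α.degree + 1; omega)
  rwa [one_mul, map_sub, sub_eq_zero, MvPowerSeries.coeff_monomial] at this

/-- Forms of degree `D` induce all jets of order less than `M ≤ D` at the center. -/
theorem exists_form_approx (φ : FormalNeighborhood k d) (M D : ℕ) (h : M ≤ D)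
    (g : MvPowerSeries (Fin d) k) :
    ∃ f : MvPolynomial (Fin (d + 1)) k, f.IsHomogeneous D ∧
      MvPolynomial.aeval φ.coord f - g ∈ orderIdeal k d M := by
  classical
  induction M with
  | zero => exact ⟨0, MvPolynomial.isHomogeneous_zero _ _ _, mem_orderIdeal_zero _⟩
  | succ M ih =>
    obtain ⟨f, hf, hfg⟩ := ih (by omega)
    set r := MvPolynomial.aeval φ.coord f - g with hr
    let s : Finset (Fin d →₀ ℕ) :=
      (Staircase.ball d (M + 1)).finite.toFinset.filter fun α => α.degree = M
    have hs : ∀ α, α ∈ s ↔ α.degree = M := by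
      intro α
      simp only [s, Finset.mem_filter, Set.Finite.mem_toFinset, and_iff_right_iff_imp]
      intro hα
      change α.degree < M + 1
      omega
    -- The correction removes the degree `M` part of the error `r` and leaves lower degrees
    -- untouched; the power of `L_0` pads the degree to `D`.
    let c : MvPolynomial (Fin (d + 1)) k := ∑ α ∈ s, MvPolynomial.C (MvPowerSeries.coeff α r) *
      (φ.dualForm 0 ^ (D - M) * ∏ l : Fin d, φ.dualForm l.succ ^ α l)
    have hc : c.IsHomogeneous D := by
      refine MvPolynomial.IsHomogeneous.sum _ _ _ fun α hα => ?_
      refine MvPolynomial.IsHomogeneous.C_mul ?_ _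
      have h1 : (φ.dualForm 0 ^ (D - M)).IsHomogeneous (1 * (D - M)) :=
        (φ.dualForm_isHomogeneous 0).pow _
      have h2 : (∏ l : Fin d, φ.dualForm l.succ ^ α l).IsHomogeneous (∑ l, 1 * α l) :=
        MvPolynomial.IsHomogeneous.prod _ _ _ fun l _ => (φ.dualForm_isHomogeneous l.succ).pow _
      have e : 1 * (D - M) + ∑ l, 1 * α l = D := by
        have := (hs α).1 hα
        rw [Finsupp.degree_eq_sum] at this
        simp only [one_mul, this]
        omega
      have := h1.mul h2
      rwa [e] at this
    refine ⟨f - c, hf.sub hc, ?_⟩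
    intro β hβ
    have hβ' : β.degree ≤ M := Nat.lt_succ_iff.1 hβ
    have e : MvPolynomial.aeval φ.coord (f - c) - g = r - MvPolynomial.aeval φ.coord c := by
      rw [map_sub, hr]; ring
    have e2 : MvPolynomial.aeval φ.coord c = ∑ α ∈ s, (MvPowerSeries.coeff α r) •
        (φ.localForm 0 ^ (D - M) * ∏ l : Fin d, φ.localForm l.succ ^ α l) := by
      simp only [c, map_sum, map_mul, map_pow, map_prod, localForm, ← MvPolynomial.algebraMap_eq,
        AlgHom.commutes]
      simp only [← Algebra.smul_def]
    rw [e, map_sub, e2, map_sum, sub_eq_zero]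
    have e3 : ∀ α ∈ s, MvPowerSeries.coeff β ((MvPowerSeries.coeff α r) •
        (φ.localForm 0 ^ (D - M) * ∏ l : Fin d, φ.localForm l.succ ^ α l)) =
        if β = α then MvPowerSeries.coeff α r else 0 := by
      intro α hα
      rw [MvPowerSeries.coeff_smul, φ.coeff_localForm_prod _ (by rw [(hs α).1 hα]; exact hβ')]
      simp
    rw [Finset.sum_congr rfl e3, Finset.sum_ite_eq]
    split_ifs with hm
    · rfl
    · refine hfg β ?_
      rw [hs] at hm
      exact lt_of_le_of_ne hβ' hm

/-- The coordinates of the formal neighborhood in the affine chart `L_0 = 1`. -/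
noncomputable def affineCoord (φ : FormalNeighborhood k d) (i : Fin (d + 1)) :
    MvPowerSeries (Fin d) k :=
  (φ.localForm 0)⁻¹ * φ.coord i

theorem localForm_zero_mul_inv (φ : FormalNeighborhood k d) :
    φ.localForm 0 * (φ.localForm 0)⁻¹ = 1 :=
  MvPowerSeries.mul_inv_cancel _ (by rw [constantCoeff_localForm_zero]; exact one_ne_zero)

theorem aeval_affineCoord (φ : FormalNeighborhood k d) {f : MvPolynomial (Fin (d + 1)) k} {D : ℕ}
    (hf : f.IsHomogeneous D) :
    MvPolynomial.aeval φ.affineCoord f =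
      (φ.localForm 0)⁻¹ ^ D * MvPolynomial.aeval φ.coord f :=
  hf.aeval_mul _ _

theorem aeval_affineCoord_mem (φ : FormalNeighborhood k d) {f : MvPolynomial (Fin (d + 1)) k}
    {D : ℕ} (hf : f.IsHomogeneous D) (K : Ideal (MvPowerSeries (Fin d) k)) :
    MvPolynomial.aeval φ.affineCoord f ∈ K ↔ MvPolynomial.aeval φ.coord f ∈ K := by
  rw [φ.aeval_affineCoord hf]
  constructor
  · intro h
    have := K.mul_mem_left (φ.localForm 0 ^ D) h
    rwa [← mul_assoc, ← mul_pow, localForm_zero_mul_inv, one_pow, one_mul] at this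
  · exact fun h => K.mul_mem_left _ h

theorem aeval_affineCoord_dualForm (φ : FormalNeighborhood k d) (j : Fin (d + 1)) :
    MvPolynomial.aeval φ.affineCoord (φ.dualForm j) = (φ.localForm 0)⁻¹ * φ.localForm j := by
  rw [φ.aeval_affineCoord (φ.dualForm_isHomogeneous j), pow_one]
  rfl

theorem exists_affine_approx (φ : FormalNeighborhood k d) (M : ℕ)
    (g : MvPowerSeries (Fin d) k) :
    ∃ f : MvPolynomial (Fin (d + 1)) k,
      MvPolynomial.aeval φ.affineCoord f - g ∈ orderIdeal k d M := by
  obtain ⟨f, hf, h⟩ := φ.exists_form_approx M M le_rfl (φ.localForm 0 ^ M * g)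
  refine ⟨f, ?_⟩
  have := Ideal.mul_mem_left _ ((φ.localForm 0)⁻¹ ^ M) h
  rwa [mul_sub, ← φ.aeval_affineCoord hf, ← mul_assoc, ← mul_pow, mul_comm (φ.localForm 0)⁻¹,
    localForm_zero_mul_inv, one_pow, one_mul] at this

/-- A polynomial vanishing to order `M` at the center of the affine chart `L_0 = 1` belongs to
`(L_1, …, L_d)^M + (L_0 - 1)`. -/
theorem mem_pow_sup_of_aeval_affineCoord_mem (φ : FormalNeighborhood k d) (M : ℕ)
    (p : MvPolynomial (Fin (d + 1)) k)
    (hp : MvPolynomial.aeval φ.affineCoord p ∈ orderIdeal k d M) :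
    p ∈ Ideal.span (Set.range fun l : Fin d => φ.dualForm l.succ) ^ M ⊔
      Ideal.span {φ.dualForm 0 - 1} := by
  classical
  set P := Ideal.span (Set.range fun l : Fin d => φ.dualForm l.succ) with hP
  set Q := P ^ M ⊔ Ideal.span {φ.dualForm 0 - 1} with hQ
  have hX : ∀ l : Fin d, (φ.localForm 0)⁻¹ * φ.localForm l.succ - MvPowerSeries.X l ∈
      orderIdeal k d 2 := by
    intro l
    have h1 : (φ.localForm 0)⁻¹ - 1 ∈ orderIdeal k d (0 + 1) := by
      rw [mem_orderIdeal_one]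
      simp [constantCoeff_localForm_zero]
    have := mul_sub_mul_mem_orderIdeal h1 (mem_orderIdeal_zero 1) (φ.localForm_succ_sub_X_mem l)
      (mem_orderIdeal_one.2 (by simp))
    rwa [one_mul, zero_add] at this
  have hθ : ∀ q ∈ Q, MvPolynomial.aeval φ.affineCoord q ∈ orderIdeal k d M := by
    have : Q ≤ (orderIdeal k d M).comap (MvPolynomial.aeval φ.affineCoord) := by
      refine sup_le ?_ ?_
      · have h1 : P.map (MvPolynomial.aeval φ.affineCoord) ≤ orderIdeal k d 1 := by
          rw [hP, Ideal.map_span, Ideal.span_le]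
          rintro _ ⟨_, ⟨l, rfl⟩, rfl⟩
          change MvPolynomial.aeval φ.affineCoord (φ.dualForm l.succ) ∈ orderIdeal k d 1
          rw [aeval_affineCoord_dualForm, mem_orderIdeal_one, map_mul, constantCoeff_localForm,
            Matrix.one_apply_ne (Fin.succ_ne_zero l).symm, mul_zero]
        rw [← Ideal.map_le_iff_le_comap, Ideal.map_pow, ← span_X_pow_eq_orderIdeal]
        have h2 := span_X_pow_eq_orderIdeal (k := k) (d := d) 1
        rw [pow_one] at h2
        rw [h2]
        exact Ideal.pow_right_mono h1 M
      · rw [Ideal.span_le, Set.singleton_subset_iff]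
        change MvPolynomial.aeval φ.affineCoord (φ.dualForm 0 - 1) ∈ orderIdeal k d M
        rw [map_sub, map_one, aeval_affineCoord_dualForm, mul_comm, localForm_zero_mul_inv,
          sub_self]
        exact zero_mem _
    exact this
  let B : Finset (Fin d →₀ ℕ) := (Staircase.ball d M).finite.toFinset
  have hB : ∀ α, α ∈ B ↔ α.degree < M := fun α => by
    simp only [B, Set.Finite.mem_toFinset]; rfl
  let mon : (Fin d →₀ ℕ) → MvPolynomial (Fin (d + 1)) k :=
    fun α => ∏ l : Fin d, φ.dualForm l.succ ^ α l
  have hmon : ∀ α, α ∉ B → mon α ∈ Q := by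
    intro α hα
    rw [hB, not_lt] at hα
    refine Ideal.mem_sup_left (Ideal.pow_le_pow_right hα ?_)
    rw [Finsupp.degree_eq_sum]
    rw [← Finset.prod_pow_eq_pow_sum]
    exact Ideal.prod_mem_prod fun l _ =>
      Ideal.pow_mem_pow (Ideal.subset_span (Set.mem_range_self l)) _
  -- Modulo `Q` one may set `L_0 = 1` and drop products of `M` or more of the `L_l`; only
  -- combinations of the `mon α` with `|α| < M` remain.
  have hred : ∀ q : MvPolynomial (Fin (d + 1)) k, ∃ c : (Fin d →₀ ℕ) → k,
      MvPolynomial.aeval φ.dualForm q - ∑ α ∈ B, MvPolynomial.C (c α) * mon α ∈ Q := by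
    intro q
    induction q using MvPolynomial.induction_on' with
    | monomial γ a =>
      let α : Fin d →₀ ℕ := Finsupp.equivFunOnFinite.symm fun l => γ l.succ
      have e : MvPolynomial.aeval φ.dualForm (MvPolynomial.monomial γ a) =
          MvPolynomial.C a * (φ.dualForm 0 ^ γ 0 * mon α) := by
        rw [MvPolynomial.aeval_monomial, Finsupp.prod_fintype _ _ (by simp), Fin.prod_univ_succ]
        rfl
      have h1 : MvPolynomial.aeval φ.dualForm (MvPolynomial.monomial γ a) -
          MvPolynomial.C a * mon α ∈ Q := by
        have e2 : MvPolynomial.aeval φ.dualForm (MvPolynomial.monomial γ a) -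
          MvPolynomial.C a * mon α = MvPolynomial.C a * mon α * (φ.dualForm 0 ^ γ 0 - 1) := by
          rw [e]; ring
        rw [e2]
        refine Ideal.mul_mem_left _ _ (Ideal.mem_sup_right ?_)
        rw [Ideal.mem_span_singleton]
        simpa using sub_dvd_pow_sub_pow (φ.dualForm 0) 1 (γ 0)
      by_cases hα : α ∈ B
      · refine ⟨Pi.single α a, ?_⟩
        rw [Finset.sum_eq_single α]
        · simpa using h1
        · intro β _ hβ
          rw [Pi.single_eq_of_ne hβ]
          simp
        · exact fun h => absurd hα h
      · refine ⟨0, ?_⟩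
        have := add_mem h1 (Ideal.mul_mem_left Q (MvPolynomial.C a) (hmon α hα))
        simpa using this
    | add p q hp hq =>
      obtain ⟨c, hc⟩ := hp
      obtain ⟨c', hc'⟩ := hq
      refine ⟨c + c', ?_⟩
      have := add_mem hc hc'
      convert this using 1
      simp only [Pi.add_apply, map_add, add_mul, Finset.sum_add_distrib]
      ring
  have hsurj : ∃ q : MvPolynomial (Fin (d + 1)) k, MvPolynomial.aeval φ.dualForm q = p := by
    refine ⟨MvPolynomial.aeval
      (fun i => ∑ j, MvPolynomial.C (φ.jacobian j i) * MvPolynomial.X j) p, ?_⟩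
    rw [← AlgHom.comp_apply]
    have : (MvPolynomial.aeval φ.dualForm).comp (MvPolynomial.aeval
      (fun i => ∑ j, MvPolynomial.C (φ.jacobian j i) * MvPolynomial.X j)) =
        AlgHom.id k (MvPolynomial (Fin (d + 1)) k) := by
      ext1 i
      rw [AlgHom.comp_apply, MvPolynomial.aeval_X, AlgHom.id_apply, φ.X_eq_sum_dualForm i]
      simp [MvPolynomial.algebraMap_eq]
    rw [this, AlgHom.id_apply]
  obtain ⟨q, rfl⟩ := hsurj
  obtain ⟨c, hc⟩ := hred q
  have hsum : ∑ α ∈ B, c α • ∏ l : Fin d, ((φ.localForm 0)⁻¹ * φ.localForm l.succ) ^ α l ∈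
      orderIdeal k d M := by
    have := sub_mem hp (hθ _ hc)
    rw [← map_sub, sub_sub_cancel, map_sum] at this
    convert this using 1
    refine Finset.sum_congr rfl fun α _ => ?_
    simp only [mon, map_mul, map_prod, map_pow, aeval_affineCoord_dualForm,
      ← MvPolynomial.algebraMap_eq, AlgHom.commutes]
    rw [Algebra.smul_def]
  -- The remainder still has order at least `M`, while the pull back of `mon α` starts with `x^α`;
  -- so its coefficients vanish degree by degree.
  have hc0 : ∀ N, ∀ α ∈ B, α.degree = N → c α = 0 := by
    intro N
    induction N using Nat.strong_induction_on with
    | _ N ih =>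
      intro α hα hN
      have h := hsum α ((hB α).1 hα)
      rw [map_sum, Finset.sum_eq_single α] at h
      · rw [MvPowerSeries.coeff_smul, coeff_prod_pow hX le_rfl, if_pos rfl, mul_one] at h
        exact h
      · intro β hβ hne
        rw [MvPowerSeries.coeff_smul]
        by_cases hlt : β.degree < N
        · rw [ih _ hlt β hβ rfl, zero_mul]
        · rw [coeff_prod_pow hX (by omega), if_neg hne.symm, mul_zero]
      · exact fun h => absurd hα h
  have hz : ∑ α ∈ B, MvPolynomial.C (c α) * mon α = 0 :=
    Finset.sum_eq_zero fun α hα => by rw [hc0 _ α hα rfl, map_zero, zero_mul]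
  rwa [hz, sub_zero] at hc

end FormalNeighborhood

/-! ### Jets of forms at several points. -/

open FormalNeighborhood in
/-- Forms of large degree induce all jets at finitely many distinct points. -/
theorem exists_form_approx_of_injective {k : Type*} [Field k] {d : ℕ} {ι : Type*} [Fintype ι]
    (φ : ι → FormalNeighborhood k d) (hφ : Function.Injective fun i => (φ i).center) (M : ℕ) :
    ∃ D₀, ∀ D ≥ D₀, ∀ g : ι → MvPowerSeries (Fin d) k,
      ∃ f : MvPolynomial (Fin (d + 1)) k, f.IsHomogeneous D ∧
        ∀ i, MvPolynomial.aeval (φ i).coord f - g i ∈ orderIdeal k d M := by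
  classical
  have hw : ∀ i l, ∃ w : Fin (d + 1) → k, i ≠ l →
      MvPolynomial.eval (φ l).center.rep (linForm w) = 0 ∧
      MvPolynomial.eval (φ i).center.rep (linForm w) ≠ 0 := by
    intro i l
    by_cases h : i = l
    · exact ⟨0, fun h' => absurd h h'⟩
    · obtain ⟨w, hw⟩ := exists_linForm_of_ne (hφ.ne (Ne.symm h))
      exact ⟨w, fun _ => hw⟩
  choose w hw using hw
  -- `h i` vanishes to order `M` at the other centers and is a unit at the `i`-th one, so it
  -- suffices to approximate `(h i)⁻¹ g i` there and add up the products.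
  let h : ι → MvPolynomial (Fin (d + 1)) k := fun i => ∏ l ∈ Finset.univ.erase i, linForm (w i l) ^ M
  let e : ℕ := ∑ l : ι, M
  have hh : ∀ i, ∃ e' ≤ e, (h i).IsHomogeneous e' := by
    intro i
    refine ⟨∑ l ∈ Finset.univ.erase i, 1 * M, ?_, MvPolynomial.IsHomogeneous.prod _ _ _
      fun l _ => (linForm_isHomogeneous _).pow M⟩
    simp only [one_mul]
    exact Finset.sum_le_sum_of_subset (Finset.erase_subset _ _)
  choose e' he' hh using hh
  have hu : ∀ i, MvPowerSeries.constantCoeff (MvPolynomial.aeval (φ i).coord (h i)) ≠ 0 := by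
    intro i
    simp only [h, map_prod, map_pow]
    refine Finset.prod_ne_zero_iff.2 fun l hl => pow_ne_zero _ ?_
    have := (hw i l (Finset.ne_of_mem_erase hl).symm).2
    rwa [Ne, (φ i).eval_center_eq_zero_iff (linForm_isHomogeneous _)] at this
  have hz : ∀ i l, i ≠ l → MvPolynomial.aeval (φ l).coord (h i) ∈ orderIdeal k d M := by
    intro i l hil
    simp only [h, map_prod, map_pow]
    refine Ideal.mem_of_dvd _ (Finset.dvd_prod_of_mem _
      (Finset.mem_erase.2 ⟨hil.symm, Finset.mem_univ l⟩)) (pow_mem_orderIdeal ?_)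
    have := (hw i l hil).1
    rwa [(φ l).eval_center_eq_zero_iff (linForm_isHomogeneous _), ← mem_orderIdeal_one] at this
  refine ⟨e + M, fun D hD g => ?_⟩
  have hf : ∀ i, ∃ f : MvPolynomial (Fin (d + 1)) k, f.IsHomogeneous (D - e' i) ∧
      MvPolynomial.aeval (φ i).coord f -
        (MvPolynomial.aeval (φ i).coord (h i))⁻¹ * g i ∈ orderIdeal k d M := fun i =>
    (φ i).exists_form_approx M (D - e' i) (by have := he' i; omega) _
  choose f hf hfg using hf
  refine ⟨∑ i, f i * h i, ?_, ?_⟩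
  · refine MvPolynomial.IsHomogeneous.sum _ _ _ fun i _ => ?_
    have := (hf i).mul (hh i)
    rwa [Nat.sub_add_cancel (by have := he' i; omega)] at this
  · intro i
    rw [map_sum, ← Finset.add_sum_erase _ _ (Finset.mem_univ i), add_sub_right_comm]
    refine add_mem ?_ (Ideal.sum_mem _ fun l hl => ?_)
    · have := Ideal.mul_mem_left _ (MvPolynomial.aeval (φ i).coord (h i)) (hfg i)
      rw [mul_sub, ← mul_assoc, MvPowerSeries.mul_inv_cancel _ (hu i), one_mul] at this
      rwa [map_mul, mul_comm]
    · rw [map_mul]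
      exact Ideal.mul_mem_left _ _ (hz l i (Finset.ne_of_mem_erase hl))

/-! ### Ideal, length and support of a union of monomial subschemes. -/

section MonomialSubscheme

variable {k : Type*} [Field k] {d : ℕ} {ι : Type*}

/-- Substituting `T x_i` records the degree as the power of `T`. Defining the ideal through this
substitution tests each homogeneous component separately, which makes it homogeneous. -/
theorem coeff_aeval_C_mul_X (x : Fin (d + 1) → MvPowerSeries (Fin d) k)
    (f : MvPolynomial (Fin (d + 1)) k) (m : ℕ) :
    (MvPolynomial.aeval (fun i => Polynomial.X * Polynomial.C (x i)) f).coeff m =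
      MvPolynomial.aeval x (MvPolynomial.homogeneousComponent m f) := by
  classical
  have h : ∀ g : MvPolynomial (Fin (d + 1)) k,
      MvPolynomial.aeval (fun i => Polynomial.C (x i)) g =
        Polynomial.C (MvPolynomial.aeval x g) := by
    intro g
    have := MvPolynomial.map_aeval (R := k) x Polynomial.C g
    rw [this, MvPolynomial.aeval_def]
    rfl
  conv_lhs => rw [← MvPolynomial.sum_homogeneousComponent f]
  rw [map_sum, Polynomial.finsetSum_coeff]
  have e : ∀ n, (MvPolynomial.aeval (fun i => Polynomial.X * Polynomial.C (x i))
      (MvPolynomial.homogeneousComponent n f)).coeff m =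
      if m = n then MvPolynomial.aeval x (MvPolynomial.homogeneousComponent n f) else 0 := by
    intro n
    rw [(MvPolynomial.homogeneousComponent_isHomogeneous n f).aeval_mul, h, mul_comm,
      Polynomial.coeff_C_mul, Polynomial.coeff_X_pow, mul_ite, mul_one, mul_zero]
  simp only [e, Finset.sum_ite_eq]
  split_ifs with hm
  · rfl
  · rw [MvPolynomial.homogeneousComponent_eq_zero, map_zero]
    simpa using hm

/-- The homogeneous ideal of the disjoint union of the monomial subschemes with staircases `E_i`
in the formal neighborhoods `φ_i`. -/
noncomputable def monomialSubschemeIdeal (φ : ι → FormalNeighborhood k d) (E : ι → Staircase d) :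
    Ideal (MvPolynomial (Fin (d + 1)) k) :=
  ⨅ i, (((E i).monomialIdeal k).map Polynomial.C).comap
    (MvPolynomial.aeval fun l => Polynomial.X * Polynomial.C ((φ i).coord l))

variable {φ : ι → FormalNeighborhood k d} {E : ι → Staircase d}

theorem mem_monomialSubschemeIdeal {f : MvPolynomial (Fin (d + 1)) k} :
    f ∈ monomialSubschemeIdeal φ E ↔ ∀ i m, MvPolynomial.aeval (φ i).coord
      (MvPolynomial.homogeneousComponent m f) ∈ (E i).monomialIdeal k := by
  simp only [monomialSubschemeIdeal, Ideal.mem_iInf, Ideal.mem_comap, Ideal.mem_map_C_iff,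
    coeff_aeval_C_mul_X]

theorem MvPolynomial.IsHomogeneous.mem_monomialSubschemeIdeal_iff
    {f : MvPolynomial (Fin (d + 1)) k} {D : ℕ} (hf : f.IsHomogeneous D) :
    f ∈ monomialSubschemeIdeal φ E ↔
      ∀ i, MvPolynomial.aeval (φ i).coord f ∈ (E i).monomialIdeal k := by
  rw [mem_monomialSubschemeIdeal]
  refine forall_congr' fun i => ⟨fun h => ?_, fun h m => ?_⟩
  · have := h D
    rwa [MvPolynomial.homogeneousComponent_eq_self hf] at this
  · rw [MvPolynomial.homogeneousComponent_of_mem hf]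
    split_ifs
    · exact h
    · simp

theorem aeval_mem_of_mem_monomialSubschemeIdeal {f : MvPolynomial (Fin (d + 1)) k}
    (hf : f ∈ monomialSubschemeIdeal φ E) (i : ι) :
    MvPolynomial.aeval (φ i).coord f ∈ (E i).monomialIdeal k := by
  rw [← MvPolynomial.sum_homogeneousComponent f, map_sum]
  exact Ideal.sum_mem _ fun m _ => mem_monomialSubschemeIdeal.1 hf i m

theorem homogeneousComponent_mem_monomialSubschemeIdeal {f : MvPolynomial (Fin (d + 1)) k}
    (hf : f ∈ monomialSubschemeIdeal φ E) (m : ℕ) :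
    MvPolynomial.homogeneousComponent m f ∈ monomialSubschemeIdeal φ E := by
  rw [(MvPolynomial.homogeneousComponent_isHomogeneous m f).mem_monomialSubschemeIdeal_iff]
  exact fun i => mem_monomialSubschemeIdeal.1 hf i m

theorem monomialSubschemeIdeal_saturated {f : MvPolynomial (Fin (d + 1)) k}
    (hf : ∃ N : ℕ, ∀ i, MvPolynomial.X i ^ N * f ∈ monomialSubschemeIdeal φ E) :
    f ∈ monomialSubschemeIdeal φ E := by
  obtain ⟨N, hN⟩ := hf
  simp only [monomialSubschemeIdeal, Ideal.mem_iInf, Ideal.mem_comap, Ideal.mem_map_C_iff] at hN ⊢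
  intro i m
  -- Some coordinate is a unit in the formal neighborhood, so its power can be cancelled there.
  have hne : ∃ l, MvPowerSeries.constantCoeff ((φ i).coord l) ≠ 0 := by
    by_contra! h
    exact (φ i).linearIndependent.ne_zero 0 (funext h)
  obtain ⟨l, hl⟩ := hne
  have := hN l i (m + N)
  rw [map_mul, map_pow, MvPolynomial.aeval_X, mul_pow, mul_assoc,
    Polynomial.coeff_X_pow_mul, ← map_pow, Polynomial.coeff_C_mul] at this
  have h2 := Ideal.mul_mem_left _ (((φ i).coord l)⁻¹ ^ N) this
  rwa [← mul_assoc, ← mul_pow, MvPowerSeries.inv_mul_cancel _ hl, one_pow, one_mul] at h2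

variable (φ E) in
/-- The coefficients of the pull backs of a polynomial with exponents in the staircases. -/
noncomputable def jetMap : MvPolynomial (Fin (d + 1)) k →ₗ[k] ((Σ i, (E i).carrier) → k) :=
  LinearMap.pi fun x => (MvPowerSeries.coeff x.2.1).comp
    (MvPolynomial.aeval (φ x.1).coord).toLinearMap

theorem ker_jetMap_comp_subtype (m : ℕ) :
    LinearMap.ker ((jetMap φ E).comp (Forms k d m).subtype) =
      idealForms (monomialSubschemeIdeal φ E) m := by
  ext ⟨f, hf⟩
  rw [LinearMap.mem_ker]
  change _ ↔ f ∈ monomialSubschemeIdeal φ E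
  rw [MvPolynomial.IsHomogeneous.mem_monomialSubschemeIdeal_iff hf]
  constructor
  · intro h i α hα
    exact congrFun h ⟨i, α, hα⟩
  · intro h
    ext ⟨i, α, hα⟩
    exact h i α hα

instance Staircase.instFiniteCarrier (E : Staircase d) : Finite E.carrier := E.finite

/-- This bound holds in every degree, whereas the equality below needs a degree depending on `φ`.
Uniformity matters because the limit argument fixes `m` and varies the neighborhoods. -/
theorem finrank_idealForms_le [Finite ι] (m : ℕ) :
    Module.finrank k (Forms k d m ⧸ idealForms (monomialSubschemeIdeal φ E) m) ≤
      Nat.card (Σ i, (E i).carrier) := by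
  cases nonempty_fintype (Σ i, (E i).carrier)
  rw [← ker_jetMap_comp_subtype,
    (LinearMap.quotKerEquivRange ((jetMap φ E).comp (Forms k d m).subtype)).finrank_eq,
    Nat.card_eq_fintype_card, ← Module.finrank_fintype_fun_eq_card k]
  exact Submodule.finrank_le _

theorem exists_jetMap_surjective [Finite ι] (hφ : Function.Injective fun i => (φ i).center) :
    ∃ D₀, ∀ D ≥ D₀, Function.Surjective ((jetMap φ E).comp (Forms k d D).subtype) := by
  classical
  cases nonempty_fintype ι
  choose M hM using fun i => exists_orderIdeal_le (k := k) (E i)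
  obtain ⟨D₀, h⟩ := exists_form_approx_of_injective φ hφ (Finset.univ.sup M)
  refine ⟨D₀, fun D hD c => ?_⟩
  let g : ι → MvPowerSeries (Fin d) k :=
    fun i α => if hα : α ∈ (E i).carrier then c ⟨i, α, hα⟩ else 0
  obtain ⟨f, hf, hfc⟩ := h D hD g
  refine ⟨⟨f, hf⟩, ?_⟩
  ext ⟨i, α, hα⟩
  have := hM i (orderIdeal_anti (Finset.le_sup (Finset.mem_univ i)) (hfc i)) α hα
  rw [map_sub, sub_eq_zero] at this
  refine this.trans ?_
  exact dif_pos hα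

theorem exists_finrank_idealForms_eq [Finite ι]
    (hφ : Function.Injective fun i => (φ i).center) :
    ∃ D₀, ∀ D ≥ D₀, Module.finrank k (Forms k d D ⧸ idealForms (monomialSubschemeIdeal φ E) D) =
      Nat.card (Σ i, (E i).carrier) := by
  cases nonempty_fintype (Σ i, (E i).carrier)
  obtain ⟨D₀, h⟩ := exists_jetMap_surjective (E := E) hφ
  refine ⟨D₀, fun D hD => ?_⟩
  rw [← ker_jetMap_comp_subtype, (LinearMap.quotKerEquivOfSurjective _ (h D hD)).finrank_eq,
    Nat.card_eq_fintype_card, Module.finrank_fintype_fun_eq_card]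

theorem pullback_monomialSubschemeIdeal [Finite ι]
    (hφ : Function.Injective fun i => (φ i).center) (i : ι) :
    (φ i).pullback (monomialSubschemeIdeal φ E) = (E i).monomialIdeal k := by
  classical
  cases nonempty_fintype ι
  apply le_antisymm
  · rw [FormalNeighborhood.pullback, Ideal.map_le_iff_le_comap]
    exact fun f hf => aeval_mem_of_mem_monomialSubschemeIdeal hf i
  · refine monomialIdeal_le_of_approx _ _ fun M g hg => ?_
    choose N hN using fun i => exists_orderIdeal_le (k := k) (E i)
    -- Order `M` gives the wanted accuracy at the `i`-th point; the bounds `N` force the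
    -- approximating form into the ideal at all points.
    obtain ⟨D, h⟩ := exists_form_approx_of_injective φ hφ (M ⊔ Finset.univ.sup N)
    obtain ⟨f, hf, hfg⟩ := h D le_rfl (Pi.single i g)
    have hfN : ∀ l, MvPolynomial.aeval (φ l).coord f - (Pi.single i g : ι → _) l ∈
        (E l).monomialIdeal k := fun l => hN l (orderIdeal_anti
          ((Finset.le_sup (Finset.mem_univ l)).trans le_sup_right) (hfg l))
    have hfJ : f ∈ monomialSubschemeIdeal φ E := by
      rw [hf.mem_monomialSubschemeIdeal_iff]
      intro l
      have hl : (Pi.single i g : ι → MvPowerSeries (Fin d) k) l ∈ (E l).monomialIdeal k := by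
        by_cases hil : l = i
        · subst hil
          rwa [Pi.single_eq_same]
        · rw [Pi.single_eq_of_ne hil]
          exact zero_mem _
      simpa using add_mem (hfN l) hl
    have h1 := orderIdeal_anti (le_sup_left : M ≤ _) (hfg i)
    rw [Pi.single_eq_same] at h1
    have h2 : MvPolynomial.aeval (φ i).coord f ∈
        (φ i).pullback (monomialSubschemeIdeal φ E) := Ideal.mem_map_of_mem _ hfJ
    have := sub_mem (Ideal.mem_sup_left h2) (Ideal.mem_sup_right h1)
    rwa [sub_sub_cancel] at this

/-- A product of high powers of linear forms, each vanishing at one center but not at `q`, lies in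
the ideal and separates off `q`. -/
theorem exists_eq_center_of_onSubscheme [Finite ι] {q : Projectivization k (Fin (d + 1) → k)}
    (hq : OnSubscheme (monomialSubschemeIdeal φ E) q) : ∃ i, q = (φ i).center := by
  classical
  cases nonempty_fintype ι
  by_contra! h
  choose w hw hw' using fun i => exists_linForm_of_ne (h i).symm
  choose M hM using fun i => exists_orderIdeal_le (k := k) (E i)
  have hf : (∏ i, linForm (w i) ^ M i).IsHomogeneous (∑ i, 1 * M i) :=
    MvPolynomial.IsHomogeneous.prod _ _ _ fun l _ => (linForm_isHomogeneous _).pow _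
  have := hq (∏ i, linForm (w i) ^ M i) (by
    rw [hf.mem_monomialSubschemeIdeal_iff]
    intro i
    rw [map_prod]
    refine Ideal.mem_of_dvd _ (Finset.dvd_prod_of_mem _ (Finset.mem_univ i)) ?_
    rw [map_pow]
    refine hM i (pow_mem_orderIdeal ?_)
    rw [mem_orderIdeal_one, ← FormalNeighborhood.eval_center_eq_zero_iff _
      (linForm_isHomogeneous _)]
    exact hw i)
  rw [map_prod, Finset.prod_eq_zero_iff] at this
  obtain ⟨i, _, hi⟩ := this
  rw [map_pow] at hi
  exact hw' i (eq_zero_of_pow_eq_zero hi)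

/-- The disjoint union of the monomial subschemes with staircases `E_i` in the formal
neighborhoods `φ_i`. -/
noncomputable def monomialSubscheme [Finite ι] (φ : ι → FormalNeighborhood k d)
    (E : ι → Staircase d) (hφ : Function.Injective fun i => (φ i).center) {n : ℕ}
    (hn : Nat.card (Σ i, (E i).carrier) = n) : HilbPoint k d n where
  ideal := monomialSubschemeIdeal φ E
  homogeneous _ hf m := homogeneousComponent_mem_monomialSubschemeIdeal hf m
  saturated _ hf := monomialSubschemeIdeal_saturated hf
  hilbertPolynomial := by
    obtain ⟨D₀, h⟩ := exists_finrank_idealForms_eq (E := E) hφ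
    exact Filter.eventually_atTop.2 ⟨D₀, fun D hD => (h D hD).trans hn⟩

theorem monomialSubscheme_mem_stratum {r n : ℕ} {φ : Fin r → FormalNeighborhood k d}
    {E : Fin r → Staircase d} (hφ : Function.Injective fun i => (φ i).center)
    (hn : Nat.card (Σ i, (E i).carrier) = n) :
    (⟨n, monomialSubscheme φ E hφ hn⟩ : Hilb k d) ∈ stratum k E :=
  ⟨φ, hφ, pullback_monomialSubschemeIdeal hφ, fun _ hq => exists_eq_center_of_onSubscheme hq⟩

end MonomialSubscheme

/-! ### Uniqueness: local data and support determine the saturated ideal. -/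

section Homogenize

variable {k : Type*} [Field k] {d : ℕ}

/-- If a multiple `p f` of a form `f` belongs to a homogeneous ideal modulo `ℓ - 1`, where `ℓ` is a
linear form, then so does a homogeneous multiple, without `ℓ - 1`. -/
theorem exists_homogeneous_mul_mem {I : Ideal (MvPolynomial (Fin (d + 1)) k)}
    (hI : ∀ f ∈ I, ∀ m, MvPolynomial.homogeneousComponent m f ∈ I)
    {ℓ : MvPolynomial (Fin (d + 1)) k} (hℓ : ℓ.IsHomogeneous 1)
    {f : MvPolynomial (Fin (d + 1)) k} {e : ℕ} (hf : f.IsHomogeneous e)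
    {p : MvPolynomial (Fin (d + 1)) k} (hp : p * f ∈ I ⊔ Ideal.span {ℓ - 1}) :
    ∃ (D : ℕ) (g : MvPolynomial (Fin (d + 1)) k), g.IsHomogeneous D ∧ g * f ∈ I ∧
      ∀ x, MvPolynomial.eval x ℓ = 1 → MvPolynomial.eval x g = MvPolynomial.eval x p := by
  -- In the quotient by `I` with `ℓ` inverted, the map `τ : X_i ↦ X_i / ℓ` dehomogenizes: it kills
  -- `I`, by homogeneity, and also `ℓ - 1`.
  let A := Localization.Away (Ideal.Quotient.mk I ℓ)
  let ξ : MvPolynomial (Fin (d + 1)) k →ₐ[k] A :=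
    (IsScalarTower.toAlgHom k (MvPolynomial (Fin (d + 1)) k ⧸ I) A).comp (Ideal.Quotient.mkₐ k I)
  have hξ : ∀ q, ξ q = algebraMap (MvPolynomial (Fin (d + 1)) k ⧸ I) A (Ideal.Quotient.mk I q) :=
    fun _ => rfl
  have hξI : ∀ q ∈ I, ξ q = 0 := fun q hq => by
    rw [hξ, Ideal.Quotient.eq_zero_iff_mem.2 hq, map_zero]
  have hξker : ∀ q, ξ q = 0 → ∃ N : ℕ, ℓ ^ N * q ∈ I := by
    intro q hq
    rw [hξ, IsLocalization.map_eq_zero_iff (Submonoid.powers (Ideal.Quotient.mk I ℓ))] at hq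
    obtain ⟨⟨_, N, rfl⟩, h⟩ := hq
    refine ⟨N, ?_⟩
    rwa [← Ideal.Quotient.eq_zero_iff_mem, map_mul, map_pow]
  obtain ⟨u, hu⟩ : ∃ u : A, ξ ℓ * u = 1 :=
    (IsLocalization.Away.algebraMap_isUnit (Ideal.Quotient.mk I ℓ)).exists_right_inv
  let τ : MvPolynomial (Fin (d + 1)) k →ₐ[k] A := MvPolynomial.aeval fun i => u * ξ (MvPolynomial.X i)
  have hτ : ∀ {q : MvPolynomial (Fin (d + 1)) k} {m : ℕ}, q.IsHomogeneous m →
      τ q = u ^ m * ξ q := by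
    intro q m hq
    refine (hq.aeval_mul u _).trans ?_
    congr 1
    exact DFunLike.congr_fun (MvPolynomial.aeval_unique ξ).symm q
  have hτI : ∀ q ∈ I, τ q = 0 := by
    intro q hq
    rw [← MvPolynomial.sum_homogeneousComponent q, map_sum]
    refine Finset.sum_eq_zero fun m _ => ?_
    rw [hτ (MvPolynomial.homogeneousComponent_isHomogeneous m q), hξI _ (hI q hq m), mul_zero]
  have hτℓ : τ ℓ = 1 := by rw [hτ hℓ, pow_one, mul_comm, hu]
  have hτp : τ (p * f) = 0 := by
    have : I ⊔ Ideal.span {ℓ - 1} ≤ RingHom.ker τ := by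
      refine sup_le (fun q hq => hτI q hq) ?_
      rw [Ideal.span_singleton_le_iff_mem, RingHom.mem_ker, map_sub, hτℓ, map_one, sub_self]
    exact this hp
  let D := p.totalDegree
  -- Homogenization of `p` by powers of `ℓ`; its image in `A` is `ℓ^D τ p`, and it agrees with `p`
  -- where `ℓ = 1`.
  let H : MvPolynomial (Fin (d + 1)) k :=
    ∑ m ∈ Finset.range (D + 1), ℓ ^ (D - m) * MvPolynomial.homogeneousComponent m p
  have hH : H.IsHomogeneous D := by
    refine MvPolynomial.IsHomogeneous.sum _ _ _ fun m hm => ?_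
    have h1 := (hℓ.pow (D - m)).mul (MvPolynomial.homogeneousComponent_isHomogeneous m p)
    rwa [one_mul, Nat.sub_add_cancel (Nat.lt_succ_iff.1 (Finset.mem_range.1 hm))] at h1
  have hpH : ξ H = ξ ℓ ^ D * τ p := by
    conv_rhs => rw [← MvPolynomial.sum_homogeneousComponent p]
    rw [map_sum, map_sum, Finset.mul_sum]
    refine Finset.sum_congr rfl fun m hm => ?_
    rw [hτ (MvPolynomial.homogeneousComponent_isHomogeneous m p), map_mul, map_pow, ← mul_assoc]
    congr 1
    have : D = D - m + m := (Nat.sub_add_cancel (Nat.lt_succ_iff.1 (Finset.mem_range.1 hm))).symm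
    conv_rhs => rw [this, pow_add, mul_assoc, ← mul_pow, hu, one_pow, mul_one]
  have hHf : ξ (H * f) = 0 := by
    have h1 : ξ f = ξ ℓ ^ e * τ f := by
      rw [hτ hf, ← mul_assoc, ← mul_pow, hu, one_pow, one_mul]
    rw [map_mul, hpH, h1, mul_mul_mul_comm, ← map_mul, hτp, mul_zero]
  obtain ⟨N, hN⟩ := hξker _ hHf
  refine ⟨1 * N + D, ℓ ^ N * H, (hℓ.pow N).mul hH, by rwa [mul_assoc], fun x hx => ?_⟩
  conv_rhs => rw [← MvPolynomial.sum_homogeneousComponent p]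
  simp [H, D, hx]

end Homogenize

section Uniqueness

variable {k : Type*} [Field k] {d : ℕ}

namespace FormalNeighborhood

/-- Elements of the pull back are combinations of elements of `I` with power series coefficients; in
the affine chart these coefficients can be replaced by polynomials up to order `M`, since degrees no
longer matter. -/
theorem exists_affine_approx_of_mem_pullback (φ : FormalNeighborhood k d)
    {I : Ideal (MvPolynomial (Fin (d + 1)) k)}
    (hI : ∀ f ∈ I, ∀ m, MvPolynomial.homogeneousComponent m f ∈ I) (M : ℕ)
    {a : MvPowerSeries (Fin d) k} (ha : a ∈ φ.pullback I) :
    ∃ h ∈ I, MvPolynomial.aeval φ.affineCoord h - a ∈ orderIdeal k d M := by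
  have h1 : φ.pullback I ≤ I.map (MvPolynomial.aeval φ.affineCoord) := by
    rw [pullback, Ideal.map_le_iff_le_comap]
    intro f hf
    rw [Ideal.mem_comap, ← MvPolynomial.sum_homogeneousComponent f, map_sum]
    refine Ideal.sum_mem _ fun m _ => ?_
    rw [← φ.aeval_affineCoord_mem (MvPolynomial.homogeneousComponent_isHomogeneous m f)]
    exact Ideal.mem_map_of_mem _ (hI f hf m)
  have h2 := h1 ha
  rw [Ideal.map] at h2
  clear ha
  induction h2 using Submodule.span_induction with
  | mem x hx =>
    obtain ⟨f, hf, rfl⟩ := hx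
    exact ⟨f, hf, by rw [sub_self]; exact zero_mem _⟩
  | zero => exact ⟨0, zero_mem _, by simp⟩
  | add x y _ _ hx hy =>
    obtain ⟨f, hf, hfx⟩ := hx
    obtain ⟨g, hg, hgy⟩ := hy
    refine ⟨f + g, add_mem hf hg, ?_⟩
    have := add_mem hfx hgy
    rwa [sub_add_sub_comm, ← map_add] at this
  | smul r x _ hx =>
    obtain ⟨f, hf, hfx⟩ := hx
    obtain ⟨b, hb⟩ := φ.exists_affine_approx M r
    refine ⟨b * f, Ideal.mul_mem_left _ _ hf, ?_⟩
    have e : MvPolynomial.aeval φ.affineCoord (b * f) - r • x =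
        (MvPolynomial.aeval φ.affineCoord b - r) * MvPolynomial.aeval φ.affineCoord f +
          r * (MvPolynomial.aeval φ.affineCoord f - x) := by
      rw [map_mul, smul_eq_mul]; ring
    rw [e]
    exact add_mem (Ideal.mul_mem_right _ _ hb) (Ideal.mul_mem_left _ _ hfx)

/-- A form whose pull back to a formal neighborhood belongs to the pull back of `I` belongs to `I`
after multiplication by a form which does not vanish at the center. -/
theorem exists_mul_mem_of_aeval_mem_pullback (φ : FormalNeighborhood k d)
    {I : Ideal (MvPolynomial (Fin (d + 1)) k)}
    (hI : ∀ f ∈ I, ∀ m, MvPolynomial.homogeneousComponent m f ∈ I)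
    {f : MvPolynomial (Fin (d + 1)) k} {e : ℕ} (hf : f.IsHomogeneous e)
    (hfI : MvPolynomial.aeval φ.coord f ∈ φ.pullback I) :
    ∃ (D : ℕ) (g : MvPolynomial (Fin (d + 1)) k), g.IsHomogeneous D ∧ g * f ∈ I ∧
      MvPolynomial.eval φ.center.rep g ≠ 0 := by
  set P := Ideal.span (Set.range fun l : Fin d => φ.dualForm l.succ) with hP
  set Q := I ⊔ Ideal.span {φ.dualForm 0 - 1} with hQ
  have h1 : ∀ M, f ∈ Q ⊔ P ^ M := by
    intro M
    rw [← φ.aeval_affineCoord_mem hf] at hfI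
    obtain ⟨h, hh, hhf⟩ := φ.exists_affine_approx_of_mem_pullback hI M hfI
    rw [← map_sub] at hhf
    have h2 := φ.mem_pow_sup_of_aeval_affineCoord_mem M _ hhf
    have h3 : P ^ M ⊔ Ideal.span {φ.dualForm 0 - 1} ≤ Q ⊔ P ^ M :=
      sup_le le_sup_right (le_sup_right.trans le_sup_left)
    have h4 := sub_mem (Ideal.mem_sup_left (Ideal.mem_sup_left hh)) (h3 h2)
    rwa [sub_sub_cancel] at h4
  have h2 : (Ideal.Quotient.mk Q f) ∈
      (⨅ M : ℕ, P ^ M • ⊤ : Submodule (MvPolynomial (Fin (d + 1)) k)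
        (MvPolynomial (Fin (d + 1)) k ⧸ Q)) := by
    rw [Submodule.mem_iInf]
    intro M
    obtain ⟨q, hq, p, hp, hqp⟩ := Submodule.mem_sup.1 (h1 M)
    rw [← hqp, map_add, Ideal.Quotient.eq_zero_iff_mem.2 hq, zero_add]
    have : Ideal.Quotient.mk Q p = p • (1 : MvPolynomial (Fin (d + 1)) k ⧸ Q) := by
      rw [Algebra.smul_def, mul_one]; rfl
    rw [this]
    exact Submodule.smul_mem_smul hp trivial
  -- Krull's intersection theorem: `f` lies in every `Q + P^M`, so some `1 - r` with `r ∈ P`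
  -- multiplies it into `Q`; and `1 - r` takes the value one at the center.
  obtain ⟨⟨r, hr⟩, hrf⟩ := (P.mem_iInf_smul_pow_eq_bot_iff _).1 h2
  have h3 : (1 - r) * f ∈ Q := by
    rw [sub_mul, one_mul, ← Ideal.Quotient.eq_zero_iff_mem, map_sub, sub_eq_zero, map_mul]
    exact hrf.symm
  obtain ⟨D, g, hg, hgf, hgx⟩ :=
    exists_homogeneous_mul_mem hI (φ.dualForm_isHomogeneous 0) hf h3
  refine ⟨D, g, hg, hgf, ?_⟩
  have h4 : ∀ j, MvPolynomial.eval (fun i => MvPowerSeries.constantCoeff (φ.coord i))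
      (φ.dualForm j) = MvPowerSeries.constantCoeff (φ.localForm j) := fun j =>
    (φ.constantCoeff_aeval _).symm
  have h5 : MvPolynomial.eval (fun i => MvPowerSeries.constantCoeff (φ.coord i)) r = 0 := by
    have : P ≤ RingHom.ker
        (MvPolynomial.eval fun i => MvPowerSeries.constantCoeff (φ.coord i)) := by
      rw [hP, Ideal.span_le]
      rintro _ ⟨l, rfl⟩
      change MvPolynomial.eval _ _ = 0
      rw [h4, constantCoeff_localForm, Matrix.one_apply_ne (Fin.succ_ne_zero l).symm]
    exact this hr
  have h6 := hgx (fun i => MvPowerSeries.constantCoeff (φ.coord i))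
    (by rw [h4, constantCoeff_localForm_zero])
  rw [Ne, φ.eval_center_eq_zero_iff hg, constantCoeff_aeval, h6, map_sub, map_one, h5, sub_zero]
  exact one_ne_zero

end FormalNeighborhood

/-- A subscheme which is monomial in the formal neighborhoods `φ_i` and contains no other point is
determined by the `φ_i` and the staircases. -/
theorem HilbPoint.ideal_eq_monomialSubschemeIdeal [IsAlgClosed k] {n : ℕ} {ι : Type*}
    (Z : HilbPoint k d n) {φ : ι → FormalNeighborhood k d} {E : ι → Staircase d}
    (hpull : ∀ i, (φ i).pullback Z.ideal = (E i).monomialIdeal k)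
    (hsupp : ∀ q, OnSubscheme Z.ideal q → ∃ i, q = (φ i).center) :
    Z.ideal = monomialSubschemeIdeal φ E := by
  apply le_antisymm
  · intro f hf
    rw [mem_monomialSubschemeIdeal]
    intro i m
    rw [← hpull]
    exact Ideal.mem_map_of_mem _ (Z.homogeneous f hf m)
  suffices h : ∀ (e : ℕ) (f : MvPolynomial (Fin (d + 1)) k), f.IsHomogeneous e →
      f ∈ monomialSubschemeIdeal φ E → f ∈ Z.ideal by
    intro f hf
    rw [← MvPolynomial.sum_homogeneousComponent f]
    exact Ideal.sum_mem _ fun m _ => h m _ (MvPolynomial.homogeneousComponent_isHomogeneous m f)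
      (homogeneousComponent_mem_monomialSubschemeIdeal hf m)
  intro e f hf hfJ
  -- The colon ideal `(I : f)`. It is shown to have no zero but the origin, so by the
  -- Nullstellensatz it contains powers of all variables, and saturation yields `f ∈ I`.
  let K : Ideal (MvPolynomial (Fin (d + 1)) k) :=
    Submodule.comap (LinearMap.toSpanSingleton _ _ f) Z.ideal
  have hzero : ∀ x ∈ MvPolynomial.zeroLocus k K, x = 0 := by
    intro x hx
    by_contra hx0
    let q := Projectivization.mk k x hx0
    obtain ⟨a, ha⟩ := Projectivization.exists_smul_eq_mk_rep k x hx0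
    have hne : ∃ (D : ℕ) (g : MvPolynomial (Fin (d + 1)) k), g.IsHomogeneous D ∧ g ∈ K ∧
        MvPolynomial.eval q.rep g ≠ 0 := by
      by_cases hq : ∃ i, q = (φ i).center
      · obtain ⟨i, hi⟩ := hq
        rw [hi]
        refine (φ i).exists_mul_mem_of_aeval_mem_pullback Z.homogeneous hf ?_
        rw [hpull]
        exact hf.mem_monomialSubschemeIdeal_iff.1 hfJ i
      · have hq' := mt (hsupp q) hq
        simp only [OnSubscheme, not_forall] at hq'
        obtain ⟨g, hg, hgq⟩ := hq'
        have : ∃ m, MvPolynomial.eval q.rep (MvPolynomial.homogeneousComponent m g) ≠ 0 := by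
          by_contra! h
          apply hgq
          rw [← MvPolynomial.sum_homogeneousComponent g, map_sum]
          exact Finset.sum_eq_zero fun m _ => h m
        obtain ⟨m, hm⟩ := this
        exact ⟨m, _, MvPolynomial.homogeneousComponent_isHomogeneous m g,
          Ideal.mul_mem_right _ _ (Z.homogeneous g hg m), hm⟩
    obtain ⟨D, g, hg, hgK, hgq⟩ := hne
    apply hgq
    have : q.rep = (a : k) • x := ha.symm
    rw [this, hg.eval_smul]
    have := hx g hgK
    rw [MvPolynomial.aeval_eq_eval] at this
    rw [this, mul_zero]
  have hX : ∀ i, ∃ N : ℕ, MvPolynomial.X i ^ N ∈ K := by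
    intro i
    have : MvPolynomial.X i ∈ K.radical := by
      rw [← MvPolynomial.vanishingIdeal_zeroLocus_eq_radical (K := k),
        MvPolynomial.mem_vanishingIdeal_iff]
      intro x hx
      rw [hzero x hx]
      simp
    exact this
  choose N hN using hX
  refine Z.saturated f ⟨Finset.univ.sup N, fun i => ?_⟩
  exact K.mem_of_dvd (pow_dvd_pow _ (Finset.le_sup (Finset.mem_univ i))) (hN i)

end Uniqueness

/-! ### Newton interpolation in one variable. -/

/-- The coefficient of `∏_{i < l} (x - y_i)` in the expansion of `x^n` in the Newton basis with
nodes `y_0, y_1, …`. -/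
def newtonCoeff {R : Type*} [CommRing R] (y : ℕ → R) : ℕ → ℕ → R
  | 0, l => if l = 0 then 1 else 0
  | n + 1, 0 => y 0 * newtonCoeff y n 0
  | n + 1, l + 1 => newtonCoeff y n l + y (l + 1) * newtonCoeff y n (l + 1)

section Newton

theorem newtonCoeff_zero_nodes {R : Type*} [CommRing R] (n l : ℕ) :
    newtonCoeff (fun _ => (0 : R)) n l = if n = l then 1 else 0 := by
  induction n generalizing l with
  | zero => cases l <;> simp [newtonCoeff]
  | succ n ih => cases l <;> simp [newtonCoeff, ih]

variable {k : Type*} [Field k]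

open Polynomial

/-- The coordinates of a polynomial in the Newton basis with nodes `y_0, y_1, …`. -/
noncomputable def newtonFunctional (y : ℕ → k) (l : ℕ) : k[X] →ₗ[k] k :=
  (Polynomial.basisMonomials k).constr k fun n => newtonCoeff y n l

theorem newtonFunctional_X_pow (y : ℕ → k) (l n : ℕ) :
    newtonFunctional y l (X ^ n) = newtonCoeff y n l := by
  have := (Polynomial.basisMonomials k).constr_basis k (fun n => newtonCoeff y n l) n
  rw [Polynomial.coe_basisMonomials] at this
  rwa [X_pow_eq_monomial]

theorem newtonFunctional_zero_X_mul (y : ℕ → k) (f : k[X]) :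
    newtonFunctional y 0 (X * f) = y 0 * newtonFunctional y 0 f := by
  induction f using Polynomial.induction_on' with
  | add p q hp hq => rw [mul_add, map_add, hp, hq, map_add, mul_add]
  | monomial n a =>
    rw [← C_mul_X_pow_eq_monomial, ← mul_assoc, X_mul_C, mul_assoc, ← pow_succ',
      ← smul_eq_C_mul, ← smul_eq_C_mul, map_smul, map_smul, newtonFunctional_X_pow,
      newtonFunctional_X_pow, newtonCoeff, smul_eq_mul, smul_eq_mul]
    ring

/-- With `N_l = ∏_{i < l} (X - y_i)` one has `X N_l = N_{l+1} + y_l N_l`, which is also the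
recursion defining `newtonCoeff`. -/
theorem newtonFunctional_succ_X_mul (y : ℕ → k) (l : ℕ) (f : k[X]) :
    newtonFunctional y (l + 1) (X * f) =
      newtonFunctional y l f + y (l + 1) * newtonFunctional y (l + 1) f := by
  induction f using Polynomial.induction_on' with
  | add p q hp hq => rw [mul_add, map_add, hp, hq, map_add, map_add]; ring
  | monomial n a =>
    rw [← C_mul_X_pow_eq_monomial, ← mul_assoc, X_mul_C, mul_assoc, ← pow_succ',
      ← smul_eq_C_mul, ← smul_eq_C_mul, map_smul, map_smul, map_smul, newtonFunctional_X_pow,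
      newtonFunctional_X_pow, newtonFunctional_X_pow, newtonCoeff, smul_eq_mul, smul_eq_mul,
      smul_eq_mul]
    ring

theorem newtonFunctional_prod (y : ℕ → k) (l L : ℕ) :
    newtonFunctional y l (∏ i ∈ Finset.range L, (X - C (y i))) = if l = L then 1 else 0 := by
  induction L generalizing l with
  | zero =>
    rw [Finset.prod_range_zero, ← pow_zero X, newtonFunctional_X_pow, newtonCoeff]
  | succ L ih =>
    rw [Finset.prod_range_succ, mul_comm, sub_mul, map_sub, ← smul_eq_C_mul, map_smul, ih,
      smul_eq_mul]
    cases l with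
    | zero =>
      rw [newtonFunctional_zero_X_mul, ih]
      by_cases h : 0 = L
      · subst h; simp
      · simp [h]
    | succ l =>
      rw [newtonFunctional_succ_X_mul, ih, ih]
      by_cases h : l = L
      · subst h; simp
      · by_cases h' : l + 1 = L
        · subst h'; simp
        · simp [h, h']

/-- Multiples of `N_L` involve only Newton basis elements of index at least `L`, because
multiplication by `X` never lowers the index. -/
theorem newtonFunctional_eq_zero_of_dvd (y : ℕ → k) {L : ℕ} {f : k[X]}
    (hf : ∏ i ∈ Finset.range L, (X - C (y i)) ∣ f) {l : ℕ} (hl : l < L) :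
    newtonFunctional y l f = 0 := by
  obtain ⟨h, rfl⟩ := hf
  induction h using Polynomial.induction_on' generalizing l with
  | add p q hp hq => rw [mul_add, map_add, hp hl, hq hl, add_zero]
  | monomial n a =>
    rw [← C_mul_X_pow_eq_monomial, mul_left_comm, ← smul_eq_C_mul, map_smul]
    suffices h : newtonFunctional y l ((∏ i ∈ Finset.range L, (X - C (y i))) * X ^ n) = 0 by
      rw [h, smul_zero]
    induction n generalizing l with
    | zero => rw [pow_zero, mul_one, newtonFunctional_prod, if_neg hl.ne]
    | succ n ih =>
      rw [pow_succ', mul_left_comm]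
      cases l with
      | zero => rw [newtonFunctional_zero_X_mul, ih hl, mul_zero]
      | succ l => rw [newtonFunctional_succ_X_mul, ih hl, ih (by omega), mul_zero, add_zero]

theorem prod_range_mul_periodic (z : ℕ → k) (a m : ℕ) :
    ∏ l ∈ Finset.range (a * m), (X - C (z (l % a))) =
      ∏ c ∈ Finset.range a, (X - C (z c)) ^ m := by
  induction m with
  | zero => simp
  | succ m ih =>
    rw [mul_add, mul_one, Finset.prod_range_add, ih]
    simp only [pow_succ, Finset.prod_mul_distrib]
    congr 1
    refine Finset.prod_congr rfl fun c hc => ?_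
    rw [Nat.mul_add_mod, Nat.mod_eq_of_lt (Finset.mem_range.1 hc)]

/-- The first `a m` periodic nodes visit each `z_c` exactly `m` times; the powers `(X - z_c)^m` are
coprime, so vanishing to order `m` at each `z_c` gives divisibility by their product. -/
theorem newtonFunctional_periodic_eq_zero {z : ℕ → k} {a m : ℕ}
    (hz : Set.InjOn z (Set.Iio a)) {f : k[X]}
    (hf : ∀ c < a, ∀ μ < m, (taylor (z c) f).coeff μ = 0) {l : ℕ} (hl : l < a * m) :
    newtonFunctional (fun i => z (i % a)) l f = 0 := by
  refine newtonFunctional_eq_zero_of_dvd _ (L := a * m) ?_ hl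
  rw [prod_range_mul_periodic]
  refine Finset.prod_dvd_of_coprime ?_ fun c hc => ?_
  · intro c hc c' hc' hne
    refine IsCoprime.pow ?_
    refine isCoprime_X_sub_C_of_isUnit_sub ?_
    rw [isUnit_iff_ne_zero, sub_ne_zero]
    exact fun h => hne (hz (by simpa using hc) (by simpa using hc') h)
  · rw [X_sub_C_pow_dvd_iff, X_pow_dvd_iff]
    intro μ hμ
    exact hf c (Finset.mem_range.1 hc) μ hμ

/-- The Newton functionals with periodic nodes are combinations of the coefficients of the Taylor
expansions at the nodes. -/
theorem exists_newtonFunctional_eq_sum {z : ℕ → k} {a m : ℕ}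
    (hz : Set.InjOn z (Set.Iio a)) {l : ℕ} (hl : l < a * m) :
    ∃ κ : Fin a × Fin m → k, ∀ f : k[X], newtonFunctional (fun i => z (i % a)) l f =
      ∑ s, κ s * (taylor (z s.1) f).coeff s.2 := by
  let L : Fin a × Fin m → k[X] →ₗ[k] k := fun s => (lcoeff k s.2).comp (taylor (z s.1))
  have hL : newtonFunctional (fun i => z (i % a)) l ∈ Submodule.span k (Set.range L) := by
    -- A linear form vanishing on the common kernel of finitely many others is a combination of
    -- them.
    refine mem_span_of_iInf_ker_le_ker fun f hf => ?_
    rw [Submodule.mem_iInf] at hf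
    exact newtonFunctional_periodic_eq_zero hz (fun c hc μ hμ => hf (⟨c, hc⟩, ⟨μ, hμ⟩)) hl
  obtain ⟨κ, hκ⟩ := (Submodule.mem_span_range_iff_exists_fun k).1 hL
  refine ⟨κ, fun f => ?_⟩
  rw [← hκ, LinearMap.sum_apply]
  rfl

end Newton

/-! ### Products of Newton functionals in several variables. -/

section ProdFunctional

variable {k : Type*} [Field k] {d : ℕ}

/-- The linear form on polynomials with the value `∏ u_i(β_i)` at `x^β`. -/
noncomputable def prodFunctional {A : Type*} [CommRing A] [Algebra k A] (u : Fin d → ℕ → A) :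
    MvPolynomial (Fin d) k →ₗ[k] A :=
  (MvPolynomial.basisMonomials (Fin d) k).constr k fun β => ∏ i, u i (β i)

theorem prodFunctional_monomial {A : Type*} [CommRing A] [Algebra k A] (u : Fin d → ℕ → A)
    (β : Fin d →₀ ℕ) :
    prodFunctional u (MvPolynomial.monomial β (1 : k)) = ∏ i, u i (β i) := by
  have := (MvPolynomial.basisMonomials (Fin d) k).constr_basis k (fun β => ∏ i, u i (β i)) β
  rwa [MvPolynomial.coe_basisMonomials] at this

theorem MvPolynomial.linearMap_ext_monomial {A : Type*} [AddCommGroup A] [Module k A]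
    {f g : MvPolynomial (Fin d) k →ₗ[k] A}
    (h : ∀ β, f (MvPolynomial.monomial β 1) = g (MvPolynomial.monomial β 1)) : f = g :=
  (MvPolynomial.basisMonomials (Fin d) k).ext fun β => by
    rw [MvPolynomial.coe_basisMonomials]; exact h β

theorem coeff_prod_aeval_X (p : Fin d → Polynomial k) (μ : Fin d →₀ ℕ) :
    MvPolynomial.coeff μ (∏ i, Polynomial.aeval (MvPolynomial.X i : MvPolynomial (Fin d) k) (p i)) =
      ∏ i, (p i).coeff (μ i) := by
  classical
  obtain ⟨N, hN⟩ : ∃ N, ∀ i, (p i).natDegree < N ∧ μ i < N := by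
    refine ⟨Finset.univ.sup (fun i => (p i).natDegree ⊔ μ i) + 1, fun i => ?_⟩
    have := Finset.le_sup (f := fun i => (p i).natDegree ⊔ μ i) (Finset.mem_univ i)
    simp only [sup_le_iff] at this
    omega
  have h1 : ∀ i, Polynomial.aeval (MvPolynomial.X i : MvPolynomial (Fin d) k) (p i) =
      ∑ n ∈ Finset.range N, MvPolynomial.C ((p i).coeff n) * MvPolynomial.X i ^ n := by
    intro i
    rw [Polynomial.aeval_eq_sum_range' (hN i).1]
    simp only [MvPolynomial.smul_eq_C_mul]
  simp only [h1]
  rw [Finset.prod_univ_sum, MvPolynomial.coeff_sum]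
  have h2 : ∀ s : Fin d → ℕ, ∏ i, (MvPolynomial.C ((p i).coeff (s i)) * MvPolynomial.X i ^ s i) =
      MvPolynomial.monomial (Finsupp.equivFunOnFinite.symm s) (∏ i, (p i).coeff (s i)) := by
    intro s
    rw [Finset.prod_mul_distrib, ← map_prod, MvPolynomial.monomial_eq,
      Finsupp.prod_fintype _ _ (by simp)]
    simp
  simp only [h2, MvPolynomial.coeff_monomial]
  rw [Finset.sum_eq_single (μ : Fin d → ℕ)]
  · rw [if_pos (by ext; simp)]
  · intro s _ hs
    rw [if_neg]
    rintro rfl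
    exact hs (by ext; simp)
  · intro h
    exact absurd (Fintype.mem_piFinset.2 fun i => Finset.mem_range.2 (hN i).2) h

theorem coeff_translate_monomial (z : Fin d → k) (β μ : Fin d →₀ ℕ) :
    MvPolynomial.coeff μ (MvPolynomial.aeval
      (fun i => MvPolynomial.X i + MvPolynomial.C (z i) : Fin d → MvPolynomial (Fin d) k)
      (MvPolynomial.monomial β (1 : k))) =
      ∏ i, (Polynomial.taylor (z i) (Polynomial.X ^ β i)).coeff (μ i) := by
  rw [← coeff_prod_aeval_X, MvPolynomial.aeval_monomial, map_one, one_mul,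
    Finsupp.prod_fintype _ _ (by simp)]
  congr 1
  refine Finset.prod_congr rfl fun i _ => ?_
  simp [Polynomial.taylor_apply, MvPolynomial.algebraMap_eq]

/-- A polynomial whose translates to all the points of a grid have no exponents in `E` has vanishing
Newton coordinates with exponents in `a.E`. -/
theorem prodFunctional_newtonCoeff_eq_zero (E : Staircase d) {a : Fin d → ℕ}
    (ha : ∀ i, 0 < a i) {z : ℕ → k} (hz : ∀ i, Set.InjOn z (Set.Iio (a i)))
    {f : MvPolynomial (Fin d) k}
    (hf : ∀ c : ∀ i, Fin (a i), ∀ μ ∈ E.carrier, MvPolynomial.coeff μ (MvPolynomial.aeval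
      (fun i => MvPolynomial.X i + MvPolynomial.C (z (c i)) : Fin d → MvPolynomial (Fin d) k) f) = 0)
    {α : Fin d →₀ ℕ} (hα : Finsupp.equivFunOnFinite.symm (fun i => α i / a i) ∈ E.carrier) :
    prodFunctional (fun i n => newtonCoeff (fun l => z (l % a i)) n (α i)) f = 0 := by
  classical
  have hl : ∀ i, α i < a i * (α i / a i + 1) := fun i => Nat.lt_mul_div_succ _ (ha i)
  choose κ hκ using fun i => exists_newtonFunctional_eq_sum (hz i) (hl i)
  let T : (Fin d → k) → (Fin d →₀ ℕ) → MvPolynomial (Fin d) k →ₗ[k] k := fun w μ =>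
    (MvPolynomial.lcoeff k μ).comp (MvPolynomial.aeval
      (fun i => MvPolynomial.X i + MvPolynomial.C (w i) :
        Fin d → MvPolynomial (Fin d) k)).toLinearMap
  -- Multiplying out the one-variable identities, with multiplicity `m = α i / a i + 1` in direction
  -- `i`, leaves Taylor coefficients at grid points with exponents at most `⌊α/a⌋`.
  have key : prodFunctional (fun i n => newtonCoeff (fun l => z (l % a i)) n (α i)) =
      ∑ s ∈ Fintype.piFinset (fun i => (Finset.univ : Finset (Fin (a i) × Fin (α i / a i + 1)))),
        (∏ i, κ i (s i)) • T (fun i => z (s i).1)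
          (Finsupp.equivFunOnFinite.symm fun i => ((s i).2 : ℕ)) := by
    refine MvPolynomial.linearMap_ext_monomial fun β => ?_
    rw [prodFunctional_monomial, LinearMap.sum_apply]
    have h1 : ∀ i, newtonCoeff (fun l => z (l % a i)) (β i) (α i) =
        ∑ s, κ i s * (Polynomial.taylor (z s.1) (Polynomial.X ^ β i)).coeff s.2 := by
      intro i
      rw [← hκ, newtonFunctional_X_pow]
    simp only [h1]
    rw [Finset.prod_univ_sum]
    refine Finset.sum_congr rfl fun s _ => ?_
    rw [Finset.prod_mul_distrib, LinearMap.smul_apply, smul_eq_mul]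
    congr 1
    exact (coeff_translate_monomial (fun i => z (s i).1) β
      (Finsupp.equivFunOnFinite.symm fun i => ((s i).2 : ℕ))).symm
  rw [key, LinearMap.sum_apply]
  refine Finset.sum_eq_zero fun s _ => ?_
  rw [LinearMap.smul_apply]
  have : T (fun i => z (s i).1) (Finsupp.equivFunOnFinite.symm fun i => ((s i).2 : ℕ)) f = 0 := by
    refine hf (fun i => (s i).1) _ (E.mem_of_le (fun i => ?_) hα)
    exact Nat.lt_succ_iff.1 (s i).2.2
  rw [this, smul_zero]

end ProdFunctional

/-! ### The scaled staircase and its cardinality. -/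

namespace Staircase

variable {d : ℕ}

/-- The number `a (m + 1) - 1` is the largest one with quotient `m` by `a`, so the corners generate
exactly the exponents whose quotients lie in `E`. -/
theorem mem_scale (E : Staircase d) {a : Fin d → ℕ} (ha : ∀ i, 0 < a i) {α : Fin d →₀ ℕ} :
    α ∈ (E.scale a).carrier ↔
      Finsupp.equivFunOnFinite.symm (fun i => α i / a i) ∈ E.carrier := by
  constructor
  · intro h
    refine h {α | Finsupp.equivFunOnFinite.symm (fun i => α i / a i) ∈ E.carrier} ⟨?_, ?_⟩
    · intro α hα β hβ
      refine hα (E.mem_of_le (fun i => ?_) hβ)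
      exact Nat.div_le_div_right (Nat.le_add_right _ _)
    · intro m hm
      have e : (Finsupp.equivFunOnFinite.symm fun i => (Finsupp.equivFunOnFinite.symm
          (fun i => a i * (m i + 1) - 1) : Fin d →₀ ℕ) i / a i) = m := by
        ext i
        change (a i * (m i + 1) - 1) / a i = m i
        have := ha i
        rw [show a i * (m i + 1) - 1 = (a i - 1) + a i * m i by rw [mul_add]; omega,
          Nat.add_mul_div_left _ _ this, Nat.div_eq_of_lt (by omega), zero_add]
      change Finsupp.equivFunOnFinite.symm _ ∈ E.carrier
      rwa [e]
  · intro h F hF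
    by_contra hα
    have h1 := hF.2 _ h
    have hle : α ≤ Finsupp.equivFunOnFinite.symm (fun i => a i * ((Finsupp.equivFunOnFinite.symm
        (fun i => α i / a i) : Fin d →₀ ℕ) i + 1) - 1) := by
      intro i
      exact Nat.le_sub_one_of_lt (Nat.lt_mul_div_succ _ (ha i))
    rw [← add_tsub_cancel_of_le hle] at h1
    exact hF.1 α hα _ h1

/-- Division with remainder by `a` identifies `a.E` with `E × ∏ [0, a_i)`. -/
noncomputable def scaleEquiv (E : Staircase d) {a : Fin d → ℕ} (ha : ∀ i, 0 < a i) :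
    (E.scale a).carrier ≃ (∀ i, Fin (a i)) × E.carrier where
  toFun α := (fun i => ⟨α.1 i % a i, Nat.mod_lt _ (ha i)⟩, ⟨_, (E.mem_scale ha).1 α.2⟩)
  invFun p := ⟨Finsupp.equivFunOnFinite.symm fun i => a i * p.2.1 i + p.1 i, by
    rw [E.mem_scale ha]
    convert p.2.2
    ext i
    change (a i * p.2.1 i + p.1 i) / a i = p.2.1 i
    rw [Nat.mul_add_div (ha i), Nat.div_eq_of_lt (p.1 i).2, add_zero]⟩
  left_inv α := by
    ext i
    exact Nat.div_add_mod (α.1 i) (a i)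
  right_inv p := by
    refine Prod.ext (funext fun i => Fin.ext ?_) (Subtype.ext (Finsupp.ext fun i => ?_))
    · change (a i * p.2.1 i + p.1 i) % a i = p.1 i
      rw [Nat.mul_add_mod, Nat.mod_eq_of_lt (p.1 i).2]
    · change (a i * p.2.1 i + p.1 i) / a i = p.2.1 i
      rw [Nat.mul_add_div (ha i), Nat.div_eq_of_lt (p.1 i).2, add_zero]

/-- Equality of lengths: the degeneration takes place inside a single `Hilb^n`. -/
theorem card_sigma_append_eq {j : ℕ} (E : Staircase d) (Es : Fin j → Staircase d)
    {a : Fin d → ℕ} (ha : ∀ i, 0 < a i) :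
    Nat.card (Σ i, (Fin.append (fun _ : Fin (∏ i, a i) => E) Es i).carrier) =
      Nat.card (Σ i, ((Fin.cons (E.scale a) Es : Fin (j + 1) → Staircase d) i).carrier) := by
  rw [Nat.card_sigma, Nat.card_sigma, Fin.sum_univ_add, Fin.sum_univ_succ]
  simp only [Fin.append_left, Fin.append_right, Fin.cons_zero, Fin.cons_succ]
  rw [Nat.card_congr (E.scaleEquiv ha), Nat.card_prod, Nat.card_pi]
  simp

end Staircase

/-! ### Polynomial dependence on the parameter `t`. -/

/-- A function given by a polynomial in one variable. -/
def IsPolynomialFun {k : Type*} [Field k] (f : k → k) : Prop :=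
  ∃ q : Polynomial k, ∀ t, q.eval t = f t

namespace IsPolynomialFun

variable {k : Type*} [Field k] {f g : k → k}

theorem const (c : k) : IsPolynomialFun fun _ : k => c := ⟨Polynomial.C c, fun t => by simp⟩

theorem id : IsPolynomialFun fun t : k => t := ⟨Polynomial.X, fun t => by simp⟩

theorem add (hf : IsPolynomialFun f) (hg : IsPolynomialFun g) :
    IsPolynomialFun fun t => f t + g t := by
  obtain ⟨p, hp⟩ := hf
  obtain ⟨q, hq⟩ := hg
  exact ⟨p + q, fun t => by rw [Polynomial.eval_add, hp, hq]⟩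

theorem mul (hf : IsPolynomialFun f) (hg : IsPolynomialFun g) :
    IsPolynomialFun fun t => f t * g t := by
  obtain ⟨p, hp⟩ := hf
  obtain ⟨q, hq⟩ := hg
  exact ⟨p * q, fun t => by rw [Polynomial.eval_mul, hp, hq]⟩

theorem sub (hf : IsPolynomialFun f) (hg : IsPolynomialFun g) :
    IsPolynomialFun fun t => f t - g t := by
  obtain ⟨p, hp⟩ := hf
  obtain ⟨q, hq⟩ := hg
  exact ⟨p - q, fun t => by rw [Polynomial.eval_sub, hp, hq]⟩

theorem sum {ι : Type*} (s : Finset ι) {f : ι → k → k} (hf : ∀ i, IsPolynomialFun (f i)) :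
    IsPolynomialFun fun t => ∑ i ∈ s, f i t := by
  choose p hp using hf
  exact ⟨∑ i ∈ s, p i, fun t => by simp only [Polynomial.eval_finsetSum, hp]⟩

theorem prod {ι : Type*} (s : Finset ι) {f : ι → k → k} (hf : ∀ i, IsPolynomialFun (f i)) :
    IsPolynomialFun fun t => ∏ i ∈ s, f i t := by
  choose p hp using hf
  exact ⟨∏ i ∈ s, p i, fun t => by simp only [Polynomial.eval_prod, hp]⟩

theorem mvPolynomial_eval {σ : Type*} {x : σ → k → k} (hx : ∀ v, IsPolynomialFun (x v))
    (F : MvPolynomial σ k) : IsPolynomialFun fun t => MvPolynomial.eval (fun v => x v t) F := by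
  induction F using MvPolynomial.induction_on with
  | C a => simpa using const a
  | add p q hp hq => simpa using hp.add hq
  | mul_X p v hp => simpa using hp.mul (hx v)

theorem det {ι : Type*} [Fintype ι] [DecidableEq ι] {A : ι → ι → k → k}
    (hA : ∀ i j, IsPolynomialFun (A i j)) :
    IsPolynomialFun fun t => (Matrix.of fun i j => A i j t).det := by
  simp only [Matrix.det_apply', Matrix.of_apply]
  exact sum _ fun σ => (const _).mul (prod _ fun i => hA _ i)

theorem eventually_ne_zero (hf : IsPolynomialFun f) (h : f 0 ≠ 0) :
    ∀ᶠ t in Filter.cofinite, f t ≠ 0 := by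
  obtain ⟨q, hq⟩ := hf
  have hq0 : q ≠ 0 := by
    rintro rfl
    exact h (by rw [← hq, Polynomial.eval_zero])
  rw [Filter.eventually_cofinite]
  refine (Polynomial.finite_setOfPred_isRoot hq0).subset fun t ht => ?_
  have ht' : f t = 0 := not_not.1 ht
  exact (hq t).trans ht'

theorem newtonCoeff {y : ℕ → k → k} (hy : ∀ l, IsPolynomialFun (y l)) (n l : ℕ) :
    IsPolynomialFun fun t => _root_.newtonCoeff (fun i => y i t) n l := by
  induction n generalizing l with
  | zero => exact const _
  | succ n ih =>
    cases l with
    | zero => exact (hy 0).mul (ih 0)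
    | succ l => exact (ih l).add ((hy (l + 1)).mul (ih (l + 1)))

theorem prodFunctional {d : ℕ} {u : k → Fin d → ℕ → k}
    (hu : ∀ i n, IsPolynomialFun fun t => u t i n) (p : MvPolynomial (Fin d) k) :
    IsPolynomialFun fun t => _root_.prodFunctional (u t) p := by
  induction p using MvPolynomial.induction_on' with
  | monomial β a =>
    have e : MvPolynomial.monomial β a = a • MvPolynomial.monomial β (1 : k) := by
      rw [MvPolynomial.smul_monomial, smul_eq_mul, mul_one]
    simp only [e, map_smul, prodFunctional_monomial, smul_eq_mul]
    exact (const a).mul (prod _ fun i => hu i _)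
  | add p q hp hq => simpa only [map_add] using hp.add hq

end IsPolynomialFun

/-! ### Plücker coordinates and limits in the Hilbert scheme. -/

section Plucker

variable {k V : Type*} [Field k] [AddCommGroup V] [Module k V]

/-- Identifying the quotient with `k^n` through `L` turns Plücker coordinates into minors of `L`.
Another basis scales them all by one factor, which is harmless because `F` is homogeneous. -/
theorem exists_basis_eval_pluckerCoord_ne_zero_iff {n e : ℕ} {F : MvPolynomial (Fin n → V) k}
    (hF : F.IsHomogeneous e) (L : V →ₗ[k] (Fin n → k)) (hL : Function.Surjective L) :
    (∃ b : Module.Basis (Fin n) k (V ⧸ LinearMap.ker L),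
      MvPolynomial.eval (pluckerCoord (LinearMap.ker L) b) F ≠ 0) ↔
      MvPolynomial.eval (fun v => (Matrix.of fun i j => L (v j) i).det) F ≠ 0 := by
  let b' : Module.Basis (Fin n) k (V ⧸ LinearMap.ker L) :=
    Module.Basis.ofEquivFun (L.quotKerEquivOfSurjective hL)
  have hb' : pluckerCoord (LinearMap.ker L) b' =
      fun v => (Matrix.of fun i j => L (v j) i).det := by
    funext v
    rw [pluckerCoord, Module.Basis.det_apply]
    rfl
  constructor
  · rintro ⟨b, hb⟩ h
    apply hb
    have e1 : pluckerCoord (LinearMap.ker L) b =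
        b.det b' • pluckerCoord (LinearMap.ker L) b' := by
      funext v
      exact DFunLike.congr_fun (b.det.eq_smul_basis_det b') _
    rw [e1, hF.eval_smul, hb', h, mul_zero]
  · intro h
    exact ⟨b', by rwa [hb']⟩

theorem surjective_of_det_ne_zero {n : ℕ} (L : V →ₗ[k] (Fin n → k)) (v : Fin n → V)
    (h : (Matrix.of fun i j => L (v j) i).det ≠ 0) : Function.Surjective L := by
  intro c
  set A : Matrix (Fin n) (Fin n) k := Matrix.of fun i j => L (v j) i with hA
  refine ⟨∑ j, (A⁻¹.mulVec c) j • v j, ?_⟩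
  have e : L (∑ j, (A⁻¹.mulVec c) j • v j) = A.mulVec (A⁻¹.mulVec c) := by
    ext i
    simp only [map_sum, map_smul, Finset.sum_apply, Pi.smul_apply, smul_eq_mul, Matrix.mulVec,
      dotProduct]
    exact Finset.sum_congr rfl fun j _ => mul_comm _ _
  rw [e, Matrix.mulVec_mulVec, Matrix.mul_nonsing_inv _ (isUnit_iff_ne_zero.2 h),
    Matrix.one_mulVec]

end Plucker

section Closure

variable {k : Type*} [Field k] {d : ℕ}

theorem HilbPoint.mem_basicOpen_iff {n m e : ℕ} {F : MvPolynomial (Fin n → Forms k d m) k}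
    (hF : F.IsHomogeneous e) {Z : HilbPoint k d n} {L : Forms k d m →ₗ[k] (Fin n → k)}
    (hL : Function.Surjective L) (hZ : LinearMap.ker L = idealForms Z.ideal m) :
    Z ∈ HilbPoint.basicOpen m F ↔
      MvPolynomial.eval (fun v => (Matrix.of fun i j => L (v j) i).det) F ≠ 0 := by
  rw [← exists_basis_eval_pluckerCoord_ne_zero_iff hF L hL, hZ]
  rfl

/-- A point `Z` of the Hilbert scheme is the limit of points `W_t` if the forms in their ideals are
the kernels of linear maps which depend polynomially on `t`. -/
theorem HilbPoint.mem_closure_of_polynomial_family [Infinite k] {n : ℕ} {Z : HilbPoint k d n}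
    {S : Set (HilbPoint k d n)} (ev : k → MvPolynomial (Fin (d + 1)) k →ₗ[k] (Fin n → k))
    (hev : ∀ f x, IsPolynomialFun fun t => ev t f x)
    (hZ : ∀ m, LinearMap.ker ((ev 0).comp (Forms k d m).subtype) = idealForms Z.ideal m)
    (hS : ∀ᶠ t in Filter.cofinite, ∃ W ∈ S, ∀ m,
      Function.Surjective ((ev t).comp (Forms k d m).subtype) →
        LinearMap.ker ((ev t).comp (Forms k d m).subtype) = idealForms W.ideal m) :
    Z ∈ closure S := by
  obtain ⟨W, hW⟩ := hS.choice
  refine mem_closure_of_tendsto (f := W) (b := Filter.cofinite) ?_ (hW.mono fun t ht => ht.1)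
  rw [TopologicalSpace.tendsto_nhds_generateFrom_iff]
  rintro _ ⟨m, F, e, hF, rfl⟩ hZF
  let L : k → Forms k d m →ₗ[k] (Fin n → k) := fun t => (ev t).comp (Forms k d m).subtype
  -- Membership of `Z` in the basic open set includes that its quotient in degree `m` has dimension
  -- `n`, which makes `L 0` onto.
  have hL0 : Function.Surjective (L 0) := by
    obtain ⟨b, -⟩ := hZF
    have h1 : Module.finrank k (LinearMap.range (L 0)) = n := by
      rw [← (LinearMap.quotKerEquivRange (L 0)).finrank_eq, hZ m, Module.finrank_eq_card_basis b,
        Fintype.card_fin]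
    rw [← LinearMap.range_eq_top]
    exact Submodule.eq_top_of_finrank_eq (by rw [h1, Module.finrank_fin_fun])
  rw [HilbPoint.mem_basicOpen_iff hF hL0 (hZ m)] at hZF
  have hdet : ∀ v : Fin n → Forms k d m,
      IsPolynomialFun fun t => (Matrix.of fun i j => L t (v j) i).det := fun v =>
    IsPolynomialFun.det fun i j => hev (v j) i
  have h1 := (IsPolynomialFun.mvPolynomial_eval hdet F).eventually_ne_zero hZF
  -- The minor on these forms is one at `t = 0`, hence nonzero, and `L t` onto, for almost all `t`.
  choose v hv using fun j : Fin n => hL0 (Pi.single j 1)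
  have h2 := (hdet v).eventually_ne_zero (by
    have : (Matrix.of fun i j => L 0 (v j) i) = (1 : Matrix (Fin n) (Fin n) k) := by
      ext i j
      rw [Matrix.of_apply, hv, Matrix.one_apply, Pi.single_apply]
    rw [this, Matrix.det_one]
    exact one_ne_zero)
  filter_upwards [hW, h1, h2] with t ht ht1 ht2
  have hsurj := surjective_of_det_ne_zero (L t) v ht2
  exact (HilbPoint.mem_basicOpen_iff hF hsurj (ht.2 m hsurj)).2 ht1

theorem eq_ker_of_finrank_quotient_le {V : Type*} [AddCommGroup V] [Module k V]
    [FiniteDimensional k V] {n : ℕ} {W : Submodule k V} {L : V →ₗ[k] (Fin n → k)}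
    (hL : Function.Surjective L) (hW : W ≤ LinearMap.ker L)
    (h : Module.finrank k (V ⧸ W) ≤ n) : LinearMap.ker L = W := by
  refine (Submodule.eq_of_le_of_finrank_le hW ?_).symm
  have h1 := Submodule.finrank_quotient_add_finrank W
  have h2 := Submodule.finrank_quotient_add_finrank (LinearMap.ker L)
  rw [(LinearMap.quotKerEquivOfSurjective L hL).finrank_eq, Module.finrank_fin_fun] at h2
  omega

instance Forms.instFiniteDimensional (m : ℕ) : FiniteDimensional k (Forms k d m) :=
  Module.Finite.of_fg (MvPolynomial.homogeneousSubmodule_fg _ _ m)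

end Closure

/-! ### Formal neighborhoods obtained by translating a polynomial map. -/

section Translate

variable {k : Type*} [Field k] {d : ℕ}

/-- The substitution `x ↦ x + z`. -/
noncomputable def polyTranslate (z : Fin d → k) :
    MvPolynomial (Fin d) k →ₐ[k] MvPolynomial (Fin d) k :=
  MvPolynomial.aeval fun i => MvPolynomial.X i + MvPolynomial.C (z i)

theorem polyTranslate_zero (p : MvPolynomial (Fin d) k) : polyTranslate (0 : Fin d → k) p = p := by
  simp [polyTranslate]

theorem coeff_zero_polyTranslate (z : Fin d → k) (p : MvPolynomial (Fin d) k) :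
    MvPolynomial.coeff 0 (polyTranslate z p) = MvPolynomial.eval z p := by
  have : (MvPolynomial.constantCoeff.comp (polyTranslate z : _ →+* MvPolynomial (Fin d) k)) =
      MvPolynomial.eval z := by
    ext i <;> simp [polyTranslate]
  exact DFunLike.congr_fun this p

theorem IsPolynomialFun.coeff_polyTranslate (w : Fin d → k) (μ : Fin d →₀ ℕ)
    (p : MvPolynomial (Fin d) k) :
    IsPolynomialFun fun t => MvPolynomial.coeff μ (polyTranslate (t • w) p) := by
  induction p using MvPolynomial.induction_on' with
  | monomial β a =>
    have e : MvPolynomial.monomial β a = a • MvPolynomial.monomial β (1 : k) := by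
      rw [MvPolynomial.smul_monomial, smul_eq_mul, mul_one]
    simp only [e, map_smul, MvPolynomial.coeff_smul, smul_eq_mul, polyTranslate,
      coeff_translate_monomial, Polynomial.taylor_coeff]
    refine (const a).mul (prod _ fun i => ?_)
    exact ⟨(Polynomial.hasseDeriv (μ i) (Polynomial.X ^ β i)).comp
      (Polynomial.X * Polynomial.C (w i)), fun t => by
        rw [Polynomial.eval_comp, Polynomial.eval_mul, Polynomial.eval_X, Polynomial.eval_C]
        rfl⟩
  | add p q hp hq => simpa only [map_add, MvPolynomial.coeff_add] using hp.add hq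

/-- First order Taylor expansion along a line through the origin. -/
theorem exists_eval_smul_eq (w : Fin d → k) (p : MvPolynomial (Fin d) k) :
    ∃ g : k → k, IsPolynomialFun g ∧
      (∀ t, MvPolynomial.eval (t • w) p = MvPolynomial.coeff 0 p + t * g t) ∧
      g 0 = ∑ l, w l * MvPolynomial.coeff (Finsupp.single l 1) p := by
  classical
  induction p using MvPolynomial.induction_on with
  | C a =>
    refine ⟨fun _ => 0, IsPolynomialFun.const 0, fun t => by simp, ?_⟩
    refine (Finset.sum_eq_zero fun l _ => ?_).symm
    rw [MvPolynomial.coeff_C, if_neg, mul_zero]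
    exact fun h => by simpa using h.symm
  | add p q hp hq =>
    obtain ⟨g, hg, hgp, hg0⟩ := hp
    obtain ⟨h, hh, hhq, hh0⟩ := hq
    refine ⟨fun t => g t + h t, hg.add hh, fun t => ?_, ?_⟩
    · rw [map_add, hgp, hhq, MvPolynomial.coeff_add]; ring
    · simp only [hg0, hh0, MvPolynomial.coeff_add, mul_add, Finset.sum_add_distrib]
  | mul_X p i hp =>
    obtain ⟨g, hg, hgp, hg0⟩ := hp
    refine ⟨fun t => (MvPolynomial.coeff 0 p + t * g t) * w i,
      ((IsPolynomialFun.const _).add (IsPolynomialFun.id.mul hg)).mul (IsPolynomialFun.const _),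
      fun t => ?_, ?_⟩
    · rw [map_mul, hgp, MvPolynomial.eval_X, MvPolynomial.coeff_mul_X', if_neg (by simp)]
      simp only [Pi.smul_apply, smul_eq_mul]
      ring
    · rw [Finset.sum_eq_single i]
      · rw [MvPolynomial.coeff_mul_X', if_pos (by simp)]
        simp [mul_comm]
      · intro l _ hl
        rw [MvPolynomial.coeff_mul_X', if_neg (by simp [hl.symm]), mul_zero]
      · simp

/-- The exponents of degree at most one. -/
noncomputable def lowExponent (d : ℕ) : Fin (d + 1) → Fin d →₀ ℕ :=
  Fin.cons 0 fun l => Finsupp.single l 1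

theorem degree_lowExponent_lt (j : Fin (d + 1)) : (lowExponent d j).degree < 2 := by
  refine Fin.cases ?_ (fun l => ?_) j
  · simp [lowExponent]
  · simp [lowExponent]

namespace FormalNeighborhood

/-- The formal neighborhood given by a polynomial map near the point `z`. -/
noncomputable def ofPolynomials (P : Fin (d + 1) → MvPolynomial (Fin d) k) (z : Fin d → k)
    (h : (Matrix.of fun j i => MvPolynomial.coeff (lowExponent d j) (polyTranslate z (P i))).det ≠ 0) :
    FormalNeighborhood k d where
  coord i := (polyTranslate z (P i) : MvPowerSeries (Fin d) k)
  linearIndependent := by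
    have h1 := Matrix.linearIndependent_rows_iff_isUnit.2
      ((Matrix.isUnit_iff_isUnit_det _).2 (isUnit_iff_ne_zero.2 h))
    convert h1 using 1
    funext j i
    refine Fin.cases ?_ (fun l => ?_) j
    · simp [Matrix.row, lowExponent, ← MvPowerSeries.coeff_zero_eq_constantCoeff_apply]
    · simp [Matrix.row, lowExponent]

theorem aeval_ofPolynomials {P : Fin (d + 1) → MvPolynomial (Fin d) k} {z : Fin d → k}
    (h : (Matrix.of fun j i => MvPolynomial.coeff (lowExponent d j) (polyTranslate z (P i))).det ≠ 0)
    (f : MvPolynomial (Fin (d + 1)) k) :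
    MvPolynomial.aeval (ofPolynomials P z h).coord f =
      (polyTranslate z (MvPolynomial.aeval P f) : MvPowerSeries (Fin d) k) := by
  have : (MvPolynomial.aeval (ofPolynomials P z h).coord : _ →ₐ[k] MvPowerSeries (Fin d) k) =
      ((MvPolynomial.coeToMvPowerSeries.algHom (σ := Fin d) (R := k) k).comp (polyTranslate z)).comp
        (MvPolynomial.aeval P) := by
    ext1 i
    simp [ofPolynomials]
  rw [this]
  simp

theorem constantCoeff_ofPolynomials {P : Fin (d + 1) → MvPolynomial (Fin d) k} {z : Fin d → k}
    (h : (Matrix.of fun j i => MvPolynomial.coeff (lowExponent d j) (polyTranslate z (P i))).det ≠ 0)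
    (i : Fin (d + 1)) : MvPowerSeries.constantCoeff ((ofPolynomials P z h).coord i) =
      MvPolynomial.eval z (P i) := by
  rw [← coeff_zero_polyTranslate, ← MvPowerSeries.coeff_zero_eq_constantCoeff_apply]
  exact MvPolynomial.coeff_coe _ _

variable (φ : FormalNeighborhood k d) {P : Fin (d + 1) → MvPolynomial (Fin d) k}

/-- The determinant is polynomial in `t`, and at `t = 0` it is that of the invertible Jacobian of
`φ`. -/
theorem eventually_det_ne_zero
    (hP : ∀ i α, α.degree < 2 → MvPolynomial.coeff α (P i) = MvPowerSeries.coeff α (φ.coord i))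
    (w : Fin d → k) : ∀ᶠ t : k in Filter.cofinite, (Matrix.of fun j i =>
      MvPolynomial.coeff (lowExponent d j) (polyTranslate (t • w) (P i))).det ≠ 0 := by
  refine IsPolynomialFun.eventually_ne_zero (f := fun t => (Matrix.of fun j i =>
      MvPolynomial.coeff (lowExponent d j) (polyTranslate (t • w) (P i))).det)
    (IsPolynomialFun.det fun j i => IsPolynomialFun.coeff_polyTranslate w (lowExponent d j) (P i)) ?_
  have e : (Matrix.of fun j i => MvPolynomial.coeff (lowExponent d j)
      (polyTranslate ((0 : k) • w) (P i))) = φ.jacobian := by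
    ext j i
    rw [Matrix.of_apply, zero_smul, polyTranslate_zero, hP _ _ (degree_lowExponent_lt j)]
    refine Fin.cases ?_ (fun l => ?_) j
    · exact MvPowerSeries.coeff_zero_eq_constantCoeff_apply _
    · rfl
  simp only [e]
  exact ((Matrix.isUnit_iff_isUnit_det _).1 φ.isUnit_jacobian).ne_zero

theorem coeff_aeval_dualForm
    (hP : ∀ i α, α.degree < 2 → MvPolynomial.coeff α (P i) = MvPowerSeries.coeff α (φ.coord i))
    (j : Fin (d + 1)) {α : Fin d →₀ ℕ} (hα : α.degree < 2) :
    MvPolynomial.coeff α (MvPolynomial.aeval P (φ.dualForm j)) =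
      MvPowerSeries.coeff α (φ.localForm j) := by
  rw [localForm, dualForm, aeval_linForm, aeval_linForm, MvPolynomial.coeff_sum, map_sum]
  refine Finset.sum_congr rfl fun i _ => ?_
  rw [MvPolynomial.coeff_smul, MvPowerSeries.coeff_smul, hP _ _ hα, smul_eq_mul]

/-- In the chart `L_0 = 1` the image of `t w` has coordinates `t w_l + O(t²)`, so images of `t w`
and `t w'` differ for almost all `t`. -/
theorem eventually_center_ne
    (hP : ∀ i α, α.degree < 2 → MvPolynomial.coeff α (P i) = MvPowerSeries.coeff α (φ.coord i))
    {w w' : Fin d → k} (hw : w ≠ w') :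
    ∀ᶠ t : k in Filter.cofinite, ∀ ψ ψ' : FormalNeighborhood k d,
      (∀ i, MvPowerSeries.constantCoeff (ψ.coord i) = MvPolynomial.eval (t • w) (P i)) →
      (∀ i, MvPowerSeries.constantCoeff (ψ'.coord i) = MvPolynomial.eval (t • w') (P i)) →
      ψ.center ≠ ψ'.center := by
  obtain ⟨l, hl⟩ := Function.ne_iff.1 hw
  let p : Fin (d + 1) → MvPolynomial (Fin d) k := fun j => MvPolynomial.aeval P (φ.dualForm j)
  have hp0 : ∀ j, MvPolynomial.coeff 0 (p j) = (1 : Matrix (Fin (d + 1)) (Fin (d + 1)) k) 0 j := by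
    intro j
    rw [φ.coeff_aeval_dualForm hP j (by simp), MvPowerSeries.coeff_zero_eq_constantCoeff_apply,
      constantCoeff_localForm]
  have hp1 : ∀ j l, MvPolynomial.coeff (Finsupp.single l 1) (p j) =
      (1 : Matrix (Fin (d + 1)) (Fin (d + 1)) k) l.succ j := by
    intro j l
    rw [φ.coeff_aeval_dualForm hP j (by simp), coeff_single_localForm]
  have hexp : ∀ v : Fin d → k, ∃ g h : k → k, IsPolynomialFun g ∧ IsPolynomialFun h ∧
      (∀ t, MvPolynomial.eval (t • v) (p 0) = 1 + t * g t) ∧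
      (∀ t, MvPolynomial.eval (t • v) (p l.succ) = t * h t) ∧ h 0 = v l := by
    intro v
    obtain ⟨g, hg, hg1, -⟩ := exists_eval_smul_eq v (p 0)
    obtain ⟨h, hh, hh1, hh0⟩ := exists_eval_smul_eq v (p l.succ)
    refine ⟨g, h, hg, hh, fun t => ?_, fun t => ?_, ?_⟩
    · rw [hg1, hp0, Matrix.one_apply_eq]
    · rw [hh1, hp0, Matrix.one_apply_ne (Fin.succ_ne_zero l).symm, zero_add]
    · rw [hh0, Finset.sum_eq_single l]
      · rw [hp1, Matrix.one_apply_eq, mul_one]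
      · intro l' _ hl'
        rw [hp1, Matrix.one_apply_ne (fun h => hl' (Fin.succ_injective _ h)), mul_zero]
      · simp
  obtain ⟨g, h, hg, hh, hg1, hh1, hh0⟩ := hexp w
  obtain ⟨g', h', hg', hh', hg1', hh1', hh0'⟩ := hexp w'
  -- The cross-multiplied difference of the two `l`-th affine coordinates, divided by `t`; its value
  -- at `t = 0` is `w_l - w'_l`.
  have hpoly : IsPolynomialFun fun t => h t * (1 + t * g' t) - h' t * (1 + t * g t) :=
    (hh.mul ((IsPolynomialFun.const 1).add (IsPolynomialFun.id.mul hg'))).sub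
      (hh'.mul ((IsPolynomialFun.const 1).add (IsPolynomialFun.id.mul hg)))
  filter_upwards [hpoly.eventually_ne_zero (by simpa [hh0, hh0', sub_eq_zero] using hl),
    Filter.eventually_cofinite_ne (0 : k)] with t ht ht0 ψ ψ' hψ hψ' hc
  apply ht
  obtain ⟨a, ha⟩ := (Projectivization.mk_eq_mk_iff' k _ _ _ _).1 hc
  have hpe : ∀ j (v : Fin d → k), MvPolynomial.eval (t • v) (p j) =
      MvPolynomial.eval (fun i => MvPolynomial.eval (t • v) (P i)) (φ.dualForm j) := by
    intro j v
    simp only [p, dualForm, aeval_linForm, eval_linForm, map_sum, MvPolynomial.smul_eval]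
  have hsc : ∀ j, MvPolynomial.eval (t • w) (p j) = a * MvPolynomial.eval (t • w') (p j) := by
    intro j
    have e : (fun i => MvPolynomial.eval (t • w) (P i)) =
        a • fun i => MvPolynomial.eval (t • w') (P i) := by
      funext i
      rw [← hψ i, ← congrFun ha i, Pi.smul_apply, Pi.smul_apply, hψ' i]
    rw [hpe, hpe, e, (φ.dualForm_isHomogeneous j).eval_smul, pow_one]
  have h0 := hsc 0
  have hl := hsc l.succ
  rw [hg1, hg1'] at h0
  rw [hh1, hh1'] at hl
  have : t * (h t * (1 + t * g' t) - h' t * (1 + t * g t)) = 0 := by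
    rw [h0]
    linear_combination (1 + t * g' t) * hl
  exact (mul_eq_zero.1 this).resolve_left ht0

/-- A linear form vanishing at the center of `ψ'` but not at that of `φ` stays nonzero at the moving
point for almost all `t`. -/
theorem eventually_center_ne_of_ne
    (hP : ∀ i α, α.degree < 2 → MvPolynomial.coeff α (P i) = MvPowerSeries.coeff α (φ.coord i))
    (w : Fin d → k) {ψ' : FormalNeighborhood k d} (hq : φ.center ≠ ψ'.center) :
    ∀ᶠ t : k in Filter.cofinite, ∀ ψ : FormalNeighborhood k d,
      (∀ i, MvPowerSeries.constantCoeff (ψ.coord i) = MvPolynomial.eval (t • w) (P i)) →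
      ψ.center ≠ ψ'.center := by
  obtain ⟨v, hv, hv'⟩ := exists_linForm_of_ne hq.symm
  have hpoly : IsPolynomialFun fun t => ∑ i, v i * MvPolynomial.eval (t • w) (P i) := by
    refine IsPolynomialFun.sum _ fun i => (IsPolynomialFun.const _).mul ?_
    simp only [← coeff_zero_polyTranslate]
    exact IsPolynomialFun.coeff_polyTranslate w 0 (P i)
  have h0 : ∑ i, v i * MvPolynomial.eval ((0 : k) • w) (P i) ≠ 0 := by
    rw [Ne, φ.eval_center_eq_zero_iff (linForm_isHomogeneous _), constantCoeff_aeval,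
      eval_linForm] at hv'
    convert hv' using 4 with i
    rw [← coeff_zero_polyTranslate, zero_smul, polyTranslate_zero, hP _ _ (by simp),
      MvPowerSeries.coeff_zero_eq_constantCoeff_apply]
  filter_upwards [hpoly.eventually_ne_zero h0] with t ht ψ hψ hc
  apply ht
  rw [← hc, ψ.eval_center_eq_zero_iff (linForm_isHomogeneous _), constantCoeff_aeval,
    eval_linForm] at hv
  simpa only [hψ] using hv

end FormalNeighborhood

end Translate

/-! ### The deformation and the inclusion of strata. -/

section Deformation

variable {k : Type*} [Field k] {d j : ℕ}

theorem aeval_sub_aeval_mem {σ A : Type*} [CommRing A] [Algebra k A] (K : Ideal A) {x y : σ → A}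
    (h : ∀ i, x i - y i ∈ K) (f : MvPolynomial σ k) :
    MvPolynomial.aeval x f - MvPolynomial.aeval y f ∈ K := by
  have e : (Ideal.Quotient.mkₐ k K).comp (MvPolynomial.aeval x) =
      (Ideal.Quotient.mkₐ k K).comp (MvPolynomial.aeval y) := by
    ext1 i
    simpa using Ideal.Quotient.eq.2 (h i)
  exact Ideal.Quotient.eq.1 (DFunLike.congr_fun e f)

theorem coe_aeval (P : Fin (d + 1) → MvPolynomial (Fin d) k) (f : MvPolynomial (Fin (d + 1)) k) :
    ((MvPolynomial.aeval P f : MvPolynomial (Fin d) k) : MvPowerSeries (Fin d) k) =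
      MvPolynomial.aeval (fun i => (P i : MvPowerSeries (Fin d) k)) f := by
  have : (MvPolynomial.aeval (fun i => (P i : MvPowerSeries (Fin d) k)) :
      _ →ₐ[k] MvPowerSeries (Fin d) k) =
      (MvPolynomial.coeToMvPowerSeries.algHom (σ := Fin d) (R := k) k).comp
        (MvPolynomial.aeval P) := by
    ext1 i
    simp
  rw [this]
  simp

theorem prodFunctional_newtonCoeff_zero_nodes (α : Fin d →₀ ℕ) (p : MvPolynomial (Fin d) k) :
    prodFunctional (fun i n => newtonCoeff (fun _ => (0 : k)) n (α i)) p =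
      MvPolynomial.coeff α p := by
  classical
  suffices h : prodFunctional (fun i n => newtonCoeff (fun _ => (0 : k)) n (α i)) =
      MvPolynomial.lcoeff k α from DFunLike.congr_fun h p
  refine MvPolynomial.linearMap_ext_monomial fun β => ?_
  rw [prodFunctional_monomial, MvPolynomial.lcoeff_apply, MvPolynomial.coeff_monomial]
  simp only [newtonCoeff_zero_nodes]
  split_ifs with h
  · subst h; simp
  · obtain ⟨i, hi⟩ := Finsupp.ne_iff.1 h
    exact Finset.prod_eq_zero (Finset.mem_univ i) (if_neg hi)

/-- The deformation with parameter `t` of the coefficients of the pull backs of polynomials: in the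
first neighborhood, approximated by the polynomial map `P`, take Newton coordinates with nodes
`t z_0, …, t z_{a_i - 1}, t z_0, …` in the direction `x_i`. -/
noncomputable def deformedJet (φ : Fin j → FormalNeighborhood k d)
    (P : Fin (d + 1) → MvPolynomial (Fin d) k) (a : Fin d → ℕ) (z : ℕ → k) (t : k)
    (i : Fin (j + 1)) (α : Fin d →₀ ℕ) : MvPolynomial (Fin (d + 1)) k →ₗ[k] k :=
  Fin.cases ((prodFunctional fun i n => newtonCoeff (fun l => t * z (l % a i)) n (α i)).comp
      (MvPolynomial.aeval P).toLinearMap)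
    (fun i => (MvPowerSeries.coeff α).comp (MvPolynomial.aeval (φ i).coord).toLinearMap) i

variable {φ : Fin j → FormalNeighborhood k d} {P : Fin (d + 1) → MvPolynomial (Fin d) k}
  {a : Fin d → ℕ} {z : ℕ → k}

theorem deformedJet_zero (t : k) (α : Fin d →₀ ℕ) (f : MvPolynomial (Fin (d + 1)) k) :
    deformedJet φ P a z t 0 α f =
      prodFunctional (fun i n => newtonCoeff (fun l => t * z (l % a i)) n (α i))
        (MvPolynomial.aeval P f) := rfl

theorem deformedJet_succ (t : k) (i : Fin j) (α : Fin d →₀ ℕ)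
    (f : MvPolynomial (Fin (d + 1)) k) : deformedJet φ P a z t i.succ α f =
      MvPowerSeries.coeff α (MvPolynomial.aeval (φ i).coord f) := rfl

theorem IsPolynomialFun.deformedJet (i : Fin (j + 1)) (α : Fin d →₀ ℕ)
    (f : MvPolynomial (Fin (d + 1)) k) :
    IsPolynomialFun fun t => _root_.deformedJet φ P a z t i α f := by
  refine Fin.cases ?_ (fun i => ?_) i
  · simp only [deformedJet_zero]
    exact prodFunctional (u := fun t i n =>
      _root_.newtonCoeff (fun l => t * z (l % a i)) n (α i)) (fun i n =>
        newtonCoeff (y := fun l t => t * z (l % a i)) (fun l => id.mul (const _)) n (α i)) _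
  · simp only [deformedJet_succ]
    exact IsPolynomialFun.const _

/-- The points of the deformed subscheme: `∏ a_i` points near the first center, at which the
staircase is `E`, and the other centers. -/
noncomputable def deformedNeighborhoods (φ : Fin j → FormalNeighborhood k d)
    (P : Fin (d + 1) → MvPolynomial (Fin d) k) (a : Fin d → ℕ) (z : ℕ → k) (t : k)
    (h : ∀ c : ∀ i, Fin (a i), (Matrix.of fun j i => MvPolynomial.coeff (lowExponent d j)
      (polyTranslate (t • fun i => z (c i)) (P i))).det ≠ 0) :
    Fin (∏ i, a i + j) → FormalNeighborhood k d :=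
  Fin.append (fun p => FormalNeighborhood.ofPolynomials P _ (h (finPiFinEquiv.symm p))) φ

/-- The deformed jets vanish on the ideal of the deformed subscheme. -/
theorem deformedJet_eq_zero (E : Staircase d) (Es : Fin j → Staircase d)
    (ha : ∀ i, 0 < a i) (hz : Function.Injective z) {t : k} (ht : t ≠ 0)
    (h : ∀ c : ∀ i, Fin (a i), (Matrix.of fun j i => MvPolynomial.coeff (lowExponent d j)
      (polyTranslate (t • fun i => z (c i)) (P i))).det ≠ 0)
    {f : MvPolynomial (Fin (d + 1)) k} {m : ℕ} (hf : f.IsHomogeneous m)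
    (hfJ : f ∈ monomialSubschemeIdeal (deformedNeighborhoods φ P a z t h)
      (Fin.append (fun _ : Fin (∏ i, a i) => E) Es)) (i : Fin (j + 1)) {α : Fin d →₀ ℕ}
    (hα : α ∈ ((Fin.cons (E.scale a) Es : Fin (j + 1) → Staircase d) i).carrier) :
    deformedJet φ P a z t i α f = 0 := by
  rw [hf.mem_monomialSubschemeIdeal_iff] at hfJ
  revert hα
  refine Fin.cases (fun hα => ?_) (fun i hα => ?_) i
  · rw [Fin.cons_zero, E.mem_scale ha] at hα
    -- The nodes `t z_l` are distinct because `t ≠ 0`.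
    refine prodFunctional_newtonCoeff_eq_zero E ha (z := fun l => t * z l)
      (fun i => (mul_right_injective₀ ht |>.comp hz).injOn) (fun c μ hμ => ?_) hα
    have h1 := hfJ (Fin.castAdd j (finPiFinEquiv c))
    rw [deformedNeighborhoods, Fin.append_left, Fin.append_left,
      FormalNeighborhood.aeval_ofPolynomials] at h1
    have h2 := h1 μ hμ
    rw [MvPolynomial.coeff_coe, Equiv.symm_apply_apply] at h2
    exact h2
  · have h1 := hfJ (Fin.natAdd _ i)
    rw [deformedNeighborhoods, Fin.append_right, Fin.append_right] at h1
    exact h1 α hα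

theorem deformedNeighborhoods_injective {t : k}
    (h : ∀ c : ∀ i, Fin (a i), (Matrix.of fun j i => MvPolynomial.coeff (lowExponent d j)
      (polyTranslate (t • fun i => z (c i)) (P i))).det ≠ 0)
    (h1 : ∀ c c' : ∀ i, Fin (a i), c ≠ c' → ∀ ψ ψ' : FormalNeighborhood k d,
      (∀ i, MvPowerSeries.constantCoeff (ψ.coord i) =
        MvPolynomial.eval (t • fun i => z (c i)) (P i)) →
      (∀ i, MvPowerSeries.constantCoeff (ψ'.coord i) =
        MvPolynomial.eval (t • fun i => z (c' i)) (P i)) → ψ.center ≠ ψ'.center)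
    (h2 : ∀ (c : ∀ i, Fin (a i)) (i : Fin j), ∀ ψ : FormalNeighborhood k d,
      (∀ i, MvPowerSeries.constantCoeff (ψ.coord i) =
        MvPolynomial.eval (t • fun i => z (c i)) (P i)) → ψ.center ≠ (φ i).center)
    (h3 : Function.Injective fun i => (φ i).center) :
    Function.Injective fun i => (deformedNeighborhoods φ P a z t h i).center := by
  intro x y
  refine Fin.addCases (fun p => ?_) (fun i => ?_) x <;>
    refine Fin.addCases (fun q => ?_) (fun i' => ?_) y <;>
    simp only [deformedNeighborhoods, Fin.append_left, Fin.append_right] <;> intro hxy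
  · by_contra hne
    refine h1 (finPiFinEquiv.symm p) (finPiFinEquiv.symm q) (fun hpq => hne ?_) _ _
      (FormalNeighborhood.constantCoeff_ofPolynomials _)
      (FormalNeighborhood.constantCoeff_ofPolynomials _) hxy
    rw [finPiFinEquiv.symm.injective hpq]
  · exact absurd hxy (h2 _ _ _ (FormalNeighborhood.constantCoeff_ofPolynomials _))
  · exact absurd hxy.symm (h2 _ _ _ (FormalNeighborhood.constantCoeff_ofPolynomials _))
  · rw [h3 hxy]

theorem stratum_scale_subset_closure [IsAlgClosed k] (E : Staircase d) (Es : Fin j → Staircase d)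
    (ha : ∀ i, 0 < a i) :
    stratum k (Fin.cons (E.scale a) Es : Fin (j + 1) → Staircase d) ⊆
      closure (stratum k (Fin.append (fun _ : Fin (∏ i, a i) => E) Es)) := by
  classical
  rintro ⟨n, Z⟩ ⟨φ, hφ, hpull, hsupp⟩
  have hZ := Z.ideal_eq_monomialSubschemeIdeal hpull hsupp
  set F : Fin (j + 1) → Staircase d := Fin.cons (E.scale a) Es with hF
  have hn : Nat.card (Σ i, (F i).carrier) = n := by
    obtain ⟨D₁, h₁⟩ := exists_finrank_idealForms_eq (E := F) hφ
    obtain ⟨D₂, h₂⟩ := Filter.eventually_atTop.1 Z.hilbertPolynomial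
    rw [← h₁ _ (le_max_left D₁ D₂), ← h₂ _ (le_max_right D₁ D₂), hZ]
  let e : Fin n ≃ Σ i, (F i).carrier := (Finite.equivFinOfCardEq hn).symm
  obtain ⟨M, hM⟩ := exists_orderIdeal_le (k := k) (E.scale a)
  -- Truncation at order `M` preserves all coefficients with exponents in `a.E`; order `2` preserves
  -- the center and the Jacobian.
  let P : Fin (d + 1) → MvPolynomial (Fin d) k := fun i =>
    MvPowerSeries.truncTotal (M ⊔ 2) ((φ 0).coord i)
  have hP : ∀ i α, α.degree < M ⊔ 2 →
      MvPolynomial.coeff α (P i) = MvPowerSeries.coeff α ((φ 0).coord i) := fun i α hα =>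
    MvPowerSeries.coeff_truncTotal _ hα
  have hP2 : ∀ i α, α.degree < 2 →
      MvPolynomial.coeff α (P i) = MvPowerSeries.coeff α ((φ 0).coord i) := fun i α hα =>
    hP i α (lt_of_lt_of_le hα le_sup_right)
  let z := Infinite.natEmbedding k
  let φ' : Fin j → FormalNeighborhood k d := fun i => φ i.succ
  let ev : k → MvPolynomial (Fin (d + 1)) k →ₗ[k] (Fin n → k) := fun t =>
    LinearMap.pi fun x => deformedJet φ' P a z t (e x).1 (e x).2.1
  have hev0 : ∀ m, LinearMap.ker ((ev 0).comp (Forms k d m).subtype) = idealForms Z.ideal m := by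
    intro m
    -- At `t = 0` all nodes coincide with the origin and Newton coordinates become coefficients;
    -- replacing `φ 0` by `P` changes pull backs only by elements of `I^{a.E}`.
    have h0 : ∀ f i α, α ∈ (F i).carrier → deformedJet φ' P a z 0 i α f =
        MvPowerSeries.coeff α (MvPolynomial.aeval (φ i).coord f) := by
      intro f i α
      refine Fin.cases (fun hα => ?_) (fun i _ => rfl) i
      rw [deformedJet_zero]
      simp only [zero_mul]
      rw [prodFunctional_newtonCoeff_zero_nodes, ← MvPolynomial.coeff_coe, coe_aeval,
        ← sub_eq_zero, ← map_sub]
      refine hM (aeval_sub_aeval_mem _ (fun i => ?_) f) α hα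
      intro β hβ
      rw [map_sub, MvPolynomial.coeff_coe, hP i β (lt_of_lt_of_le hβ le_sup_left), sub_self]
    rw [hZ, ← ker_jetMap_comp_subtype]
    ext f
    rw [LinearMap.mem_ker, LinearMap.mem_ker, funext_iff, funext_iff]
    refine e.forall_congr fun {x} => ?_
    have : ((ev 0).comp (Forms k d m).subtype) f x =
        ((jetMap φ F).comp (Forms k d m).subtype) f (e x) := h0 f (e x).1 _ (e x).2.2
    rw [this]
    rfl
  have hn' := (Staircase.card_sigma_append_eq E Es ha).trans hn
  suffices hmem : Z ∈ closure (Sigma.mk n ⁻¹'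
      stratum k (Fin.append (fun _ : Fin (∏ i, a i) => E) Es)) from
    closure_mono (Set.image_preimage_subset _ _)
      (image_closure_subset_closure_image continuous_sigmaMk (Set.mem_image_of_mem _ hmem))
  refine HilbPoint.mem_closure_of_polynomial_family ev
    (fun f x => IsPolynomialFun.deformedJet _ _ f) hev0 ?_
  have hdet := Filter.eventually_all.2 fun c : ∀ i, Fin (a i) =>
    (φ 0).eventually_det_ne_zero hP2 fun i => z (c i)
  have hne : ∀ᶠ t : k in Filter.cofinite, ∀ c c' : ∀ i, Fin (a i), c ≠ c' →
      ∀ ψ ψ' : FormalNeighborhood k d,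
      (∀ i, MvPowerSeries.constantCoeff (ψ.coord i) =
        MvPolynomial.eval (t • fun i => z (c i)) (P i)) →
      (∀ i, MvPowerSeries.constantCoeff (ψ'.coord i) =
        MvPolynomial.eval (t • fun i => z (c' i)) (P i)) → ψ.center ≠ ψ'.center := by
    refine Filter.eventually_all.2 fun c => Filter.eventually_all.2 fun c' =>
      Filter.eventually_imp_distrib_left.2 fun hcc' => (φ 0).eventually_center_ne hP2 fun h => ?_
    exact hcc' (funext fun i => Fin.ext (z.injective (congrFun h i)))
  have hne' := Filter.eventually_all.2 fun c : ∀ i, Fin (a i) => Filter.eventually_all.2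
    fun i : Fin j => (φ 0).eventually_center_ne_of_ne hP2 (fun i => z (c i)) (ψ' := φ' i)
      (hφ.ne (Fin.succ_ne_zero i).symm)
  filter_upwards [hdet, hne, hne', Filter.eventually_cofinite_ne (0 : k)] with t h h1 h2 ht
  have hinj := deformedNeighborhoods_injective h h1 h2 (hφ.comp (Fin.succ_injective _))
  refine ⟨monomialSubscheme _ _ hinj hn', monomialSubscheme_mem_stratum hinj hn',
    fun m hsurj => ?_⟩
  -- One inclusion suffices: `ev t` is onto `k^n` in degree `m`, and the forms modulo the ideal of
  -- the deformed subscheme have dimension at most `n`.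
  refine eq_ker_of_finrank_quotient_le hsurj (fun f hf => ?_)
    ((finrank_idealForms_le m).trans hn'.le)
  rw [LinearMap.mem_ker]
  ext x
  exact deformedJet_eq_zero E Es ha z.injective ht h f.2 hf _ (e x).2.2

end Deformation

theorem mainTheorem7 {k : Type*} [Field k] [IsAlgClosed k] {d j : ℕ}
    (E : Staircase d) (Es : Fin j → Staircase d) :
    (∀ a : Fin d → ℕ, (∀ i, 0 < a i) →
      stratum k (Fin.cons (E.scale a) Es : Fin (j + 1) → Staircase d) ⊆
        closure (stratum k (Fin.append (fun _ : Fin (∏ i, a i) => E) Es))) ∧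
    (∀ s : ℕ, 0 < s →
      stratum k (Fin.cons (E.scale (fun _ => s)) Es : Fin (j + 1) → Staircase d) ⊆
        closure (stratum k (Fin.append (fun _ : Fin (s ^ d) => E) Es))) := by
  refine ⟨fun a ha => stratum_scale_subset_closure E Es ha, fun s hs => ?_⟩
  have h := stratum_scale_subset_closure (k := k) E Es (a := fun _ => s) fun _ => hs
  have e : ∏ _i : Fin d, s = s ^ d := by simp
  rwa [e] at h
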